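/- **Setting.** Let $\{|n\rangle\}_{n\ge 0}$ be the Fock basis of the single-mode Hilbert space $\ell^2(\mathbb N,\mathbb C)$. Let $c,p\ge 1$ be integers and let $|C\rangle=\sum_{n=0}^{c-1}c_n|n\rangle$ with $\sum_n|c_n|^2=1$ (a core state). For a density operator $\rho$ (positive, trace one) heterodyne detection of $\rho$ returns a sample $\alpha\in\mathbb C$ with density $Q_\rho(\alpha)=\frac1\pi\langle\alpha|\rho|\alpha\rangle$, where $|\alpha\rangle=e^{-|\alpha|^2/2}\sum_n\frac{\alpha^n}{\sqrt{n!}}|n\rangle$; measuring $N$ copies gives i.i.d. samples $\alpha_1,\dots,\alpha_N$. The fidelity with a pure state is $F(\psi,\sigma)=\langle\psi|\sigma|\psi\rangle$. For $0<\eta<1$ put $$\mathcal L_{k,l}(z)=\sum_{q=0}^{\min(k,l)}\frac{\sqrt{k!}\sqrt{l!}(-1)^q}{q!(k-q)!(l-q)!}z^{l-q}\bar z^{\,k-q},\qquad f_{k,l}(z,\eta)=\eta^{-1-\frac{k+l}2}e^{(1-\frac1\eta)|z|^2}\mathcal L_{l,k}\big(\tfrac z{\sqrt\eta}\big),$$ $$g^{(p)}_{k,l}(z,\eta)=\sum_{j=0}^{p-1}(-1)^j\eta^jf_{k+j,l+j}(z,\eta)\sqrt{\tbinom{k+j}k\tbinom{l+j}l},\qquad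 g_C^{(p)}(z,\eta)=\sum_{0\le k,l\le c-1}\bar c_kc_l\,g^{(p)}_{k,l}(z,\eta)$$ ($g_C^{(p)}$ is real-valued), and let $F_C=\frac1N\sum_{i=1}^N g_C^{(p)}(\alpha_i,\eta)$ be the empirical mean and $\tilde F_C=\max(0,\min(1,F_C))$ its truncation to $[0,1]$. Put $$A=\Big(\sum_{n=0}^{c-1}|c_n|\sqrt{\tbinom{n+p}n}\Big)^2,\qquad B(\eta)=\sum_{0\le k,l\le c-1}|c_kc_l|\,\eta^{c-1-\frac{k+l}2}\tbinom{\max(k,l)+p}{p-1}\sqrt{2^{|l-k|}\tbinom{\max(k,l)}{\min(k,l)}},$$ $$K_{C,p}(\eta)=\max\left\{\frac{2A^{2c/p}B(\eta)^2(c+p)^{2+2c/p}}{c^{2c/p}p^2},\ \frac{2p^{2c-2}B(\eta)^2(c+p)^{2c+2}}{(p+1)^{2c}}\right\},$$ $$\eta_{C,p}(\epsilon)=\min\left\{\Big[\frac{c\,\epsilon}{(c+p)A}\Big]^{1/p},\ \frac{p+1}{p(p+c)}\right\}.$$ **Theorem.** 1. Let $\rho$ be any single-mode density operator, $N,M\ge1$,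 $\epsilon>0$, and $0<\eta<1$ with $\eta\le\eta_{C,p}(\epsilon/M)$. Then $$\Pr\Big[\big|F(|C\rangle^{\otimes M},\rho^{\otimes M})-\tilde F_C^{\,M}\big|\le\epsilon\Big]\ \ge\ 1-2\exp\left[-\frac{N\,\eta^{2c}}{2B(\eta)^2}\Big(\frac{p\,\epsilon}{(c+p)M}\Big)^2\right],$$ and if moreover $\eta=\eta_{C,p}(\epsilon/M)$, this probability is at least $$1-2\exp\left[-\frac{N\epsilon^{2+\frac{2c}p}}{M^{2+\frac{2c}p}K_{C,p}(\eta)}\right].$$ 2. For one copy no truncation is needed: for every $\rho$, $N\ge 1$, $0<\epsilon\le1$ and $\eta=\eta_{C,p}(\epsilon)$, $$\Pr\big[|F(|C\rangle,\rho)-F_C|\le\epsilon\big]\ \ge\ 1-2\exp\left[-\frac{N\epsilon^{2+\frac{2c}p}}{K_{C,p}(\eta)}\right].$$ 3. For $N=\mathcal O\big((M/\epsilon)^{2+2c/p}\log(1/\delta)\big)$ samples the (untruncated) estimate $F_C^M$ is $\epsilon$-close to $F(|C\rangle^{\otimes M},\rho^{\otimes M})$ with probability at least $1-\delta$. Precisely: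 for all $\epsilon_0>0$ and $0<\delta_0<1$ there is a constant $\kappa>0$ (depending only on $C,p,\epsilon_0,\delta_0$) such that for all $M\ge1$ and $0<\epsilon\le\epsilon_0$ there is a choice of the parameter $\eta\in(0,1)$, $\eta\le\eta_{C,p}(\epsilon/M)$, such that for every $\rho$, every $0<\delta\le\delta_0$ and every integer $N\ge\kappa\,(M/\epsilon)^{2+\frac{2c}p}\log(1/\delta)$, $$\Pr\Big[\big|F(|C\rangle^{\otimes M},\rho^{\otimes M})-F_C^{\,M}\big|\le\epsilon\Big]\ \ge\ 1-\delta .$$ -/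

import Mathlib

open MeasureTheory
open scoped ComplexConjugate

namespace CVFidelity

noncomputable section

/-! ### Fock space, density operators, tensor powers -/

/-- The Hilbert space with orthonormal (Fock) basis indexed by `ι`:
`ι = ℕ` for a single mode, `ι = Fin M → ℕ` for `M` modes. -/
abbrev FockSpace (ι : Type) : Type := lp (fun _ : ι => ℂ) 2

/-- The Fock basis vector `|i⟩`. -/
def ket {ι : Type} (i : ι) : FockSpace ι :=
  letI : DecidableEq ι := Classical.decEq ι
  lp.single 2 i (1 : ℂ)

/-- A density operator: a positive bounded operator of trace one. -/
structure DensityOperator (ι : Type) where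
  op : FockSpace ι →L[ℂ] FockSpace ι
  isPositive : op.IsPositive
  trace_eq_one : HasSum (fun i : ι => inner ℂ (ket i) (op (ket i))) 1

/-- The fidelity `⟨ψ|σ|ψ⟩` of a density operator `σ` with a pure state `ψ`. -/
def fidelity {ι : Type} (ψ : FockSpace ι) (σ : DensityOperator ι) : ℝ :=
  (inner ℂ ψ (σ.op ψ)).re

lemma inner_ket_left {ι : Type} (i : ι) (x : FockSpace ι) : inner ℂ (ket i) x = x i := by
  classical
  have h := lp.inner_single_left (𝕜 := ℂ) i (1 : ℂ) x
  simp only [RCLike.inner_apply, map_one, mul_one] at h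
  unfold ket
  convert h

/-- Fubini for the sum, over multi-indices, of a product of absolutely summable families. -/
lemma hasSum_prod_pi {M : ℕ} (f : Fin M → ℕ → ℂ) (a : Fin M → ℂ)
    (hf : ∀ i, HasSum (f i) (a i)) :
    (Summable fun k : Fin M → ℕ => ‖∏ i, f i (k i)‖) ∧
      HasSum (fun k : Fin M → ℕ => ∏ i, f i (k i)) (∏ i, a i) := by
  induction M with
  | zero =>
    constructor
    · exact (hasSum_fintype _).summable
    · simp
  | succ n ih =>
    obtain ⟨h1, h2⟩ := ih (fun i => f i.succ) (fun i => a i.succ) (fun i => hf i.succ)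
    have h0 : Summable fun m => ‖f 0 m‖ := (hf 0).summable.norm
    have hs := summable_mul_of_summable_norm h0 h1
    have hm := (hf 0).mul h2 hs
    have e : (fun k : Fin (n + 1) → ℕ => ∏ i, f i (k i)) ∘ (Fin.consEquiv fun _ => ℕ) =
        fun x : ℕ × (Fin n → ℕ) => f 0 x.1 * ∏ i, f i.succ (x.2 i) := by
      funext x
      simp [Fin.prod_univ_succ, Fin.consEquiv]
    have hfin : HasSum (fun k : Fin (n + 1) → ℕ => ∏ i, f i (k i)) (∏ i, a i) := by
      rw [← (Fin.consEquiv fun _ => ℕ).hasSum_iff, e, Fin.prod_univ_succ]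
      exact hm
    exact ⟨hfin.summable.norm, hfin⟩

lemma hasSum_norm_sq {ι : Type} (x : FockSpace ι) :
    HasSum (fun i => ((‖x i‖ ^ 2 : ℝ) : ℂ)) ((‖x‖ ^ 2 : ℝ) : ℂ) := by
  have h := lp.hasSum_inner (𝕜 := ℂ) x x
  simp only [inner_self_eq_norm_sq_to_K] at h
  simpa using h

lemma memlp_of_summable_sq {ι : Type} {f : ι → ℂ} (h : Summable fun i => ‖f i‖ ^ 2) :
    Memℓp f 2 := by
  apply memℓp_gen
  simpa using h

/-- The product vector `ψ 0 ⊗ ⋯ ⊗ ψ (M - 1)` of `M` single-mode vectors. -/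
def prodVec {M : ℕ} (ψ : Fin M → FockSpace ℕ) : FockSpace (Fin M → ℕ) :=
  ⟨fun k => ∏ i, ψ i (k i), by
    apply memlp_of_summable_sq
    have h := (hasSum_prod_pi _ _ fun i => hasSum_norm_sq (ψ i)).1
    refine h.congr fun k => ?_
    rw [norm_prod, norm_prod, ← Finset.prod_pow]
    refine Finset.prod_congr rfl fun i _ => ?_
    simp⟩

lemma prodVec_apply {M : ℕ} (ψ : Fin M → FockSpace ℕ) (k : Fin M → ℕ) :
    prodVec ψ k = ∏ i, ψ i (k i) := rfl

lemma inner_prodVec {M : ℕ} (φ ψ : Fin M → FockSpace ℕ) :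
    inner ℂ (prodVec φ) (prodVec ψ) = ∏ i, inner ℂ (φ i) (ψ i) := by
  have h1 := lp.hasSum_inner (𝕜 := ℂ) (prodVec φ) (prodVec ψ)
  have h2 := (hasSum_prod_pi _ _ fun i => lp.hasSum_inner (𝕜 := ℂ) (φ i) (ψ i)).2
  have e : (fun k => inner ℂ (prodVec φ k) (prodVec ψ k)) =
      fun k : Fin M → ℕ => ∏ i, inner ℂ (φ i (k i)) (ψ i (k i)) := by
    funext k
    simp only [prodVec_apply, RCLike.inner_apply, map_prod, Finset.prod_mul_distrib]
  rw [e] at h1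
  exact h1.unique h2

/-- The operator `y ↦ (⟨v_l|y⟩)_l` for a square-summable family of vectors. -/
lemma exists_analysis {ι : Type} (v : ι → FockSpace ι) (hv : Summable fun l => ‖v l‖ ^ 2) :
    ∃ R : FockSpace ι →L[ℂ] FockSpace ι, ∀ y l, R y l = inner ℂ (v l) y := by
  have hb : ∀ (y : FockSpace ι) l, ‖inner ℂ (v l) y‖ ^ 2 ≤ ‖v l‖ ^ 2 * ‖y‖ ^ 2 := fun y l => by
    rw [← mul_pow]
    exact pow_le_pow_left₀ (norm_nonneg _) (norm_inner_le_norm _ _) 2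
  have hs : ∀ y : FockSpace ι, Summable fun l => ‖inner ℂ (v l) y‖ ^ 2 := fun y =>
    Summable.of_nonneg_of_le (fun _ => sq_nonneg _) (hb y) (hv.mul_right _)
  let R₀ : FockSpace ι →ₗ[ℂ] FockSpace ι :=
    { toFun := fun y => ⟨fun l => inner ℂ (v l) y, memlp_of_summable_sq (hs y)⟩
      map_add' := fun x y => by ext l; exact inner_add_right _ _ _
      map_smul' := fun a x => by ext l; exact inner_smul_right _ _ _ }
  refine ⟨R₀.mkContinuous (Real.sqrt (∑' l, ‖v l‖ ^ 2)) fun y => ?_, fun y l => rfl⟩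
  have h := lp.norm_rpow_eq_tsum (p := 2) (by simp) (R₀ y)
  have h' : ‖R₀ y‖ ^ 2 = ∑' l, ‖inner ℂ (v l) y‖ ^ 2 := by
    have h2 := h
    simp only [ENNReal.toReal_ofNat, Real.rpow_ofNat] at h2
    exact h2
  refine (sq_le_sq₀ (norm_nonneg _) (by positivity)).1 ?_
  rw [h', mul_pow, Real.sq_sqrt (tsum_nonneg fun _ => sq_nonneg _), ← tsum_mul_right]
  exact (hs y).tsum_le_tsum (hb y) (hv.mul_right _)

lemma exists_sqrt {H : Type} [NormedAddCommGroup H] [InnerProductSpace ℂ H] [CompleteSpace H]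
    (T : H →L[ℂ] H) (hT : T.IsPositive) :
    ∃ S : H →L[ℂ] H, ∀ a b, inner ℂ (S a) (S b) = inner ℂ a (T b) := by
  have h0 : 0 ≤ T := (ContinuousLinearMap.nonneg_iff_isPositive _).2 hT
  have hSS : CFC.sqrt T * CFC.sqrt T = T := CFC.sqrt_mul_sqrt_self T h0
  have hSp : (CFC.sqrt T).IsPositive :=
    (ContinuousLinearMap.nonneg_iff_isPositive _).1 (CFC.sqrt_nonneg T)
  refine ⟨CFC.sqrt T, fun a b => ?_⟩
  conv_rhs => rw [← hSS]
  exact hSp.isSymmetric _ _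

/-- Existence of the `M`-fold tensor power of a single-mode density operator, identified by its
matrix elements in the multimode Fock basis. -/
theorem exists_tensorPower (ρ : DensityOperator ℕ) (M : ℕ) :
    ∃ σ : DensityOperator (Fin M → ℕ), ∀ k l : Fin M → ℕ,
      inner ℂ (ket k) (σ.op (ket l)) = ∏ i, inner ℂ (ket (k i)) (ρ.op (ket (l i))) := by
  obtain ⟨S, hin⟩ := exists_sqrt ρ.op ρ.isPositive
  let v : (Fin M → ℕ) → FockSpace (Fin M → ℕ) := fun k => prodVec fun i => S (ket (k i))
  have hvin : ∀ k l, inner ℂ (v k) (v l) = ∏ i, inner ℂ (ket (k i)) (ρ.op (ket (l i))) := by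
    intro k l
    simp only [v, inner_prodVec, hin]
  have htr : HasSum (fun k : Fin M → ℕ => inner ℂ (v k) (v k)) 1 := by
    have h := (hasSum_prod_pi _ _ fun _ : Fin M => ρ.trace_eq_one).2
    simp only [Finset.prod_const_one] at h
    simpa only [hvin] using h
  have hv : Summable fun k => ‖v k‖ ^ 2 := by
    refine htr.summable.norm.congr fun k => ?_
    simp [inner_self_eq_norm_sq_to_K]
  obtain ⟨R, hR⟩ := exists_analysis v hv
  have hRa : ∀ l, ContinuousLinearMap.adjoint R (ket l) = v l := by
    intro l
    refine ext_inner_right ℂ fun y => ?_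
    rw [ContinuousLinearMap.adjoint_inner_left, inner_ket_left, hR]
  have hme : ∀ k l, inner ℂ (ket k) ((R * ContinuousLinearMap.adjoint R) (ket l)) =
      inner ℂ (v k) (v l) := by
    intro k l
    rw [mul_apply_eq_comp, hRa, inner_ket_left, hR]
  refine ⟨⟨R * ContinuousLinearMap.adjoint R, ?_, ?_⟩, fun k l => (hme k l).trans (hvin k l)⟩
  · exact ContinuousLinearMap.isPositive_self_comp_adjoint R
  · simpa only [hme] using htr

/-- The state `ρ^{⊗ M}` of `M` modes: the density operator with matrix elements
`⟨k|ρ^{⊗ M}|l⟩ = ∏ i, ⟨k i|ρ|l i⟩` (a bounded operator is determined by these). -/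
def DensityOperator.tensorPower (ρ : DensityOperator ℕ) (M : ℕ) : DensityOperator (Fin M → ℕ) :=
  Classical.choose (exists_tensorPower ρ M)

lemma DensityOperator.tensorPower_spec (ρ : DensityOperator ℕ) (M : ℕ) (k l : Fin M → ℕ) :
    inner ℂ (ket k) ((ρ.tensorPower M).op (ket l)) =
      ∏ i, inner ℂ (ket (k i)) (ρ.op (ket (l i))) :=
  Classical.choose_spec (exists_tensorPower ρ M) k l

/-- The vector `ψ^{⊗ M}`. -/
def vecPower (ψ : FockSpace ℕ) (M : ℕ) : FockSpace (Fin M → ℕ) := prodVec fun _ => ψ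

/-- The vector `|C⟩ = ∑_{n < c} c_n |n⟩` (a core state when `∑ |c_n|² = 1`). -/
def coreVec {c : ℕ} (C : Fin c → ℂ) : FockSpace ℕ := ∑ n : Fin c, C n • ket (n : ℕ)

/-! ### Heterodyne detection -/

lemma coherent_memlp (α : ℂ) :
    Memℓp (fun n : ℕ =>
      (Real.exp (-‖α‖ ^ 2 / 2) : ℂ) * (α ^ n / (Real.sqrt (n.factorial : ℝ) : ℂ))) 2 := by
  apply memlp_of_summable_sq
  have h := (Real.summable_pow_div_factorial (‖α‖ ^ 2)).mul_left (Real.exp (-‖α‖ ^ 2 / 2) ^ 2)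
  refine h.congr fun n => ?_
  rw [norm_mul, norm_div, norm_pow, Complex.norm_real, Complex.norm_real, mul_pow, div_pow,
    Real.norm_eq_abs, Real.norm_eq_abs, sq_abs, sq_abs,
    Real.sq_sqrt (Nat.cast_nonneg _), ← pow_mul, ← pow_mul, mul_comm n 2]

/-- The coherent state `|α⟩ = exp(-|α|²/2) ∑ₙ αⁿ/√n! |n⟩`. -/
def coherent (α : ℂ) : FockSpace ℕ :=
  ⟨fun n : ℕ => (Real.exp (-‖α‖ ^ 2 / 2) : ℂ) * (α ^ n / (Real.sqrt (n.factorial : ℝ) : ℂ)),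
    coherent_memlp α⟩

/-- The Husimi function `Q_ρ(α) = ⟨α|ρ|α⟩ / π`. -/
def husimiQ (ρ : DensityOperator ℕ) (α : ℂ) : ℝ :=
  1 / Real.pi * (inner ℂ (coherent α) (ρ.op (coherent α))).re

/-- The law of the outcome of heterodyne detection of `ρ`: density `Q_ρ` on `ℂ`. -/
def heterodyne (ρ : DensityOperator ℕ) : Measure ℂ :=
  volume.withDensity fun α => ENNReal.ofReal (husimiQ ρ α)

/-- The joint law of the outcomes of heterodyne detection of `N` copies of `ρ`. -/
def heterodyneSamples (ρ : DensityOperator ℕ) (N : ℕ) : Measure (Fin N → ℂ) :=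
  Measure.pi fun _ => heterodyne ρ

/-! ### The estimators -/

/-- The (normalised) Laguerre 2D polynomial `𝓛_{k,l}`. -/
def laguerre2D (k l : ℕ) (z : ℂ) : ℂ :=
  ∑ p ∈ Finset.range (min k l + 1),
    ((Real.sqrt (k.factorial : ℝ) * Real.sqrt (l.factorial : ℝ) * (-1) ^ p /
      ((p.factorial : ℝ) * ((k - p).factorial : ℝ) * ((l - p).factorial : ℝ)) : ℝ) : ℂ) *
      (z ^ (l - p) * conj z ^ (k - p))

/-- `f_{k,l}(z,η) = η^{-(1+(k+l)/2)} exp((1-1/η)|z|²) 𝓛_{l,k}(z/√η)`. -/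
def fEst (k l : ℕ) (η : ℝ) (z : ℂ) : ℂ :=
  ((1 / η ^ (1 + ((k : ℝ) + l) / 2) * Real.exp ((1 - 1 / η) * ‖z‖ ^ 2) : ℝ) : ℂ) *
    laguerre2D l k (z / (Real.sqrt η : ℂ))

/-- `g_{k,l}^{(p)}(z,η) = ∑_{j<p} (-1)^j η^j f_{k+j,l+j}(z,η) √(C(k+j,k) C(l+j,l))`. -/
def gEst (p k l : ℕ) (η : ℝ) (z : ℂ) : ℂ :=
  ∑ j ∈ Finset.range p,
    (((-1) ^ j * η ^ j *
      Real.sqrt (((k + j).choose k : ℝ) * ((l + j).choose l : ℝ)) : ℝ) : ℂ) *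
      fEst (k + j) (l + j) η z

/-- `g_C^{(p)}(z,η) = ∑_{k,l<c} conj(c_k) c_l g_{k,l}^{(p)}(z,η)`, as a complex number. -/
def gCore {c : ℕ} (C : Fin c → ℂ) (p : ℕ) (η : ℝ) (z : ℂ) : ℂ :=
  ∑ k : Fin c, ∑ l : Fin c, conj (C k) * C l * gEst p k l η z

lemma conj_laguerre2D (k l : ℕ) (z : ℂ) : conj (laguerre2D k l z) = laguerre2D l k z := by
  unfold laguerre2D
  rw [map_sum, min_comm]
  refine Finset.sum_congr rfl fun p _ => ?_
  rw [map_mul, Complex.conj_ofReal, map_mul, map_pow, map_pow, Complex.conj_conj]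
  congr 1
  · congr 1
    ring
  · ring

lemma conj_gEst (p k l : ℕ) (η : ℝ) (z : ℂ) : conj (gEst p k l η z) = gEst p l k η z := by
  unfold gEst fEst
  rw [map_sum]
  refine Finset.sum_congr rfl fun j _ => ?_
  rw [map_mul, map_mul, Complex.conj_ofReal, Complex.conj_ofReal, conj_laguerre2D,
    mul_comm ((k + j).choose k : ℝ), add_comm ((k + j : ℕ) : ℝ)]

/-- The function `g_C^{(p)}` is real-valued. -/
lemma gCore_im {c : ℕ} (C : Fin c → ℂ) (p : ℕ) (η : ℝ) (z : ℂ) : (gCore C p η z).im = 0 := by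
  rw [← Complex.conj_eq_iff_im]
  unfold gCore
  simp only [map_sum, map_mul, Complex.conj_conj, conj_gEst]
  rw [Finset.sum_comm]
  refine Finset.sum_congr rfl fun k _ => Finset.sum_congr rfl fun l _ => ?_
  ring

/-- The estimate `F_C(ρ)`: the mean of the (real-valued) function `g_C^{(p)}(·,η)` over the
samples. -/
def meanEst {c : ℕ} (C : Fin c → ℂ) (p : ℕ) (η : ℝ) {N : ℕ} (α : Fin N → ℂ) : ℝ :=
  (∑ i, (gCore C p η (α i)).re) / N

/-- The estimate `F_C(ρ)` brought back into `[0,1]`: a value above `1` is replaced by `1`, a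
negative value by `0`. -/
def truncEst {c : ℕ} (C : Fin c → ℂ) (p : ℕ) (η : ℝ) {N : ℕ} (α : Fin N → ℂ) : ℝ :=
  max 0 (min 1 (meanEst C p η α))

/-! ### The constants -/

/-- `A_C^{(p)} = (∑_{n<c} |c_n| √C(n+p,n))²`. -/
def constA {c : ℕ} (C : Fin c → ℂ) (p : ℕ) : ℝ :=
  (∑ n : Fin c, ‖C n‖ * Real.sqrt (((n : ℕ) + p).choose n : ℝ)) ^ 2

/-- `B_C^{(p)}(η) = ∑_{k,l<c} |c_k c_l| η^{c-1-(k+l)/2} C(max(k,l)+p,p-1)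
√(2^{|l-k|} C(max(k,l),min(k,l)))`; here `|l-k| = max(k,l) - min(k,l)`. -/
def constB {c : ℕ} (C : Fin c → ℂ) (p : ℕ) (η : ℝ) : ℝ :=
  ∑ k : Fin c, ∑ l : Fin c,
    ‖C k * C l‖ * η ^ ((c : ℝ) - 1 - (((k : ℕ) : ℝ) + ((l : ℕ) : ℝ)) / 2) *
      ((max (k : ℕ) l + p).choose (p - 1) : ℝ) *
      Real.sqrt (2 ^ (max (k : ℕ) l - min (k : ℕ) l) *
        ((max (k : ℕ) l).choose (min (k : ℕ) l) : ℝ))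

/-- `K_{C,p}(η)`, the maximum of
`2 A^{2c/p} B(η)² (c+p)^{2+2c/p} / (c^{2c/p} p²)` and
`2 p^{2c-2} B(η)² (c+p)^{2c+2} / (p+1)^{2c}`. -/
def constK {c : ℕ} (C : Fin c → ℂ) (p : ℕ) (η : ℝ) : ℝ :=
  max
    (2 * constA C p ^ (2 * (c : ℝ) / p) * constB C p η ^ 2 *
        ((c : ℝ) + p) ^ (2 + 2 * (c : ℝ) / p) / ((c : ℝ) ^ (2 * (c : ℝ) / p) * (p : ℝ) ^ 2))
    (2 * (p : ℝ) ^ (2 * (c : ℝ) - 2) * constB C p η ^ 2 *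
        ((c : ℝ) + p) ^ (2 * (c : ℝ) + 2) / ((p : ℝ) + 1) ^ (2 * (c : ℝ)))

/-- `η_{C,p}(ε) = min ((c ε / ((c+p) A_C^{(p)}))^{1/p}) ((p+1)/(p(p+c)))`. -/
def etaMax {c : ℕ} (C : Fin c → ℂ) (p : ℕ) (ε : ℝ) : ℝ :=
  min (((c : ℝ) * ε / (((c : ℝ) + p) * constA C p)) ^ (1 / (p : ℝ)))
    (((p : ℝ) + 1) / ((p : ℝ) * ((p : ℝ) + c)))

end

end CVFidelity

open CVFidelity

/-! The estimator has a small computable bias and a bounded range; Hoeffding's inequality then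
controls its empirical mean.

Bias. Expand the Husimi function in the Fock basis and integrate against `fEst` term by term.
Gaussian moments and rotation invariance leave only the matrix elements `ρ.elem (k + j) (l + j)`,
with weight `η ^ j` times a square root of binomials (`hasSum_integral_fEst`). The element with `j =
0` is the one wanted. The alternating combination `gEst` gives the `q`-th shift the partial
alternating row sum `shiftWeight p q` of Pascal's triangle, which is `1` at `q = 0` and vanishes for
`1 ≤ q < p`. Hence the expectation of `gCore` is the fidelity plus a tail starting at order `η ^ p`.
Positivity of `ρ`, Cauchy–Schwarz and trace one bound this tail by `η ^ p * constA C p`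
(`norm_integral_gCore_sub_le`).

Range. Up to normalisation the Laguerre polynomials are matrix elements of a displacement operator,
whose columns have norm one; this gives `norm_laguerre2D_le`. The Gaussian factor of `fEst` absorbs
that growth, and summing over `j` yields `norm_gCore_le`, the bound `constB C p η / η ^ c`.

Concentration. The error is split into a share `c / (c + p)` for the bias and `p / (c + p)` for the
fluctuation (`one_sub_le_measureReal_abs_fidelity_sub_meanEst_le`). For `M` copies the target is the
`M`-th power of the one-copy fidelity (`fidelity_tensorPower`), so only the stability of `x ↦ x ^ M`
is needed: it is `M`-Lipschitz on `[0,1]` for the truncated estimate, and for the raw estimate an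
error `t` costs at most `t * M * exp (t * M)`. -/

namespace CVFidelity

open Finset

/-! ### Complex Hermite polynomials and the growth of the Laguerre 2D polynomials -/

/-- The unnormalised Laguerre 2D polynomials (complex Hermite polynomials of Itô). -/
def itoHermite (k l : ℕ) (z w : ℂ) : ℂ :=
  ∑ q ∈ range (k + 1),
    (-1) ^ q * (q.factorial : ℂ) * (k.choose q : ℂ) * (l.choose q : ℂ) * (z ^ (l - q) * w ^ (k - q))

/-- The binomials vanish beyond `min k l`, so the cut-off is immaterial; this frees the sum from its
asymmetric range. -/
lemma itoHermite_eq_sum_range (k l n : ℕ) (z w : ℂ) (hn : min k l < n) :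
    itoHermite k l z w = ∑ q ∈ range n,
      (-1) ^ q * (q.factorial : ℂ) * (k.choose q : ℂ) * (l.choose q : ℂ) *
        (z ^ (l - q) * w ^ (k - q)) := by
  have key : ∀ n, min k l < n → ∑ q ∈ range n,
      (-1) ^ q * (q.factorial : ℂ) * (k.choose q : ℂ) * (l.choose q : ℂ) *
        (z ^ (l - q) * w ^ (k - q)) = ∑ q ∈ range (min k l + 1),
      (-1) ^ q * (q.factorial : ℂ) * (k.choose q : ℂ) * (l.choose q : ℂ) *
        (z ^ (l - q) * w ^ (k - q)) := by
    intro n hn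
    symm
    refine sum_subset (range_subset_range.2 hn) fun q _ hq => ?_
    have hq' : k < q ∨ l < q := by
      rw [mem_range] at hq
      omega
    rcases hq' with h | h <;> simp [Nat.choose_eq_zero_of_lt h]
  rw [itoHermite, key n hn, key (k + 1) (by omega)]

lemma itoHermite_comm (k l : ℕ) (z w : ℂ) : itoHermite k l z w = itoHermite l k w z := by
  rw [itoHermite_eq_sum_range k l (min k l + 1) z w (by omega),
    itoHermite_eq_sum_range l k (min k l + 1) w z (by omega)]
  refine sum_congr rfl fun q _ => ?_
  ring

lemma itoHermite_zero_left (l : ℕ) (z w : ℂ) : itoHermite 0 l z w = z ^ l := by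
  simp [itoHermite]

lemma itoHermite_zero_right (k : ℕ) (z w : ℂ) : itoHermite k 0 z w = w ^ k := by
  rw [itoHermite_comm, itoHermite_zero_left]

lemma itoHermite_succ_succ (k l : ℕ) (z w : ℂ) :
    itoHermite (k + 1) (l + 1) z w =
      w * itoHermite k (l + 1) z w - (l + 1) * itoHermite k l z w := by
  rw [itoHermite_eq_sum_range k (l + 1) (k + 2) z w (by omega), itoHermite, itoHermite,
    sum_range_succ', sum_range_succ' _ (k + 1), mul_add, mul_sum, mul_sum, add_sub_right_comm,
    ← sum_sub_distrib]
  congr 1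
  · refine sum_congr rfl fun q hq => ?_
    have h1 : ((l + 1).choose (q + 1) : ℂ) * (q + 1) = (l + 1) * l.choose q := by
      exact_mod_cast (Nat.add_one_mul_choose_eq l q).symm
    rw [Nat.choose_succ_succ k q, Nat.factorial_succ, Nat.add_sub_add_right, Nat.add_sub_add_right]
    push_cast
    -- Truncated subtraction breaks the exponent identity at `q = k`, but there the binomial is
    -- zero.
    have h2 : (k.choose (q + 1) : ℂ) * w ^ (k - q) =
        (k.choose (q + 1) : ℂ) * (w * w ^ (k - (q + 1))) := by
      rcases Nat.lt_or_ge q k with h | h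
      · rw [← pow_succ']
        congr 2
        omega
      · simp [Nat.choose_eq_zero_of_lt (Nat.lt_succ_of_le h)]
    linear_combination
      (-(-1) ^ q * (q.factorial : ℂ) * (k.choose q : ℂ) * (z ^ (l - q) * w ^ (k - q))) * h1
      + ((-1) ^ (q + 1) * (q.factorial : ℂ) * (q + 1) * ((l + 1).choose (q + 1) : ℂ) * z ^ (l - q))
        * h2
  · simp
    ring

lemma itoHermite_succ_right (k l : ℕ) (z w : ℂ) :
    itoHermite (k + 1) (l + 1) z w =
      z * itoHermite (k + 1) l z w - (k + 1) * itoHermite k l z w := by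
  rw [itoHermite_comm, itoHermite_succ_succ, itoHermite_comm l (k + 1), itoHermite_comm l k]

lemma laguerre2D_eq_itoHermite (k l : ℕ) (z : ℂ) :
    laguerre2D k l z = ((1 / (Real.sqrt k.factorial * Real.sqrt l.factorial) : ℝ) : ℂ) *
      itoHermite k l z (conj z) := by
  rw [itoHermite_eq_sum_range k l (min k l + 1) _ _ (by omega), laguerre2D, mul_sum]
  refine sum_congr rfl fun q hq => ?_
  rw [mem_range] at hq
  rw [← mul_assoc]
  have hqk : q ≤ k := by omega
  have hql : q ≤ l := by omega
  have hk : (0 : ℝ) < k.factorial := by positivity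
  have hl : (0 : ℝ) < l.factorial := by positivity
  have e : Real.sqrt k.factorial * Real.sqrt l.factorial * (-1) ^ q /
      ((q.factorial : ℝ) * ((k - q).factorial : ℝ) * ((l - q).factorial : ℝ)) =
      1 / (Real.sqrt k.factorial * Real.sqrt l.factorial) *
        ((-1) ^ q * (q.factorial : ℝ) * (k.choose q : ℝ) * (l.choose q : ℝ)) := by
    rw [Nat.cast_choose ℝ hqk, Nat.cast_choose ℝ hql]
    have h1 := Real.sq_sqrt hk.le
    have h2 := Real.sq_sqrt hl.le
    have h3 := Real.sqrt_pos.2 hk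
    have h4 := Real.sqrt_pos.2 hl
    have h5 : ((q.factorial : ℕ) : ℝ) ≠ 0 := by positivity
    have h6 : (((k - q).factorial : ℕ) : ℝ) ≠ 0 := by positivity
    have h7 : (((l - q).factorial : ℕ) : ℝ) ≠ 0 := by positivity
    field_simp
    rw [h1, h2]
  rw [e]
  push_cast
  ring

/-- Crude growth in `l`, used only to make series weighted by `1 / l!` converge. The factor `l + 1`
of the recurrence is absorbed by doubling the ratio. -/
lemma exists_norm_itoHermite_le (k : ℕ) (z w : ℂ) :
    ∃ D R : ℝ, 0 ≤ D ∧ 0 ≤ R ∧ ∀ l, ‖itoHermite k l z w‖ ≤ D * R ^ l := by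
  induction k with
  | zero => exact ⟨1, ‖z‖, zero_le_one, norm_nonneg _, fun l => by simp [itoHermite_zero_left]⟩
  | succ k ih =>
    obtain ⟨D, R, hD, hR, h⟩ := ih
    refine ⟨‖w‖ ^ (k + 1) + (‖w‖ * D + D), 2 * (R + 1), by positivity, by positivity, fun l => ?_⟩
    cases l with
    | zero =>
      rw [itoHermite_zero_right, norm_pow, pow_zero, mul_one]
      have : 0 ≤ ‖w‖ * D + D := by positivity
      linarith
    | succ l =>
      have h2 : ((l : ℝ) + 1) ≤ 2 ^ (l + 1) := by
        exact_mod_cast (Nat.lt_two_pow_self (n := l + 1)).le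
      have h3 : R ^ (l + 1) ≤ (2 * (R + 1)) ^ (l + 1) := by
        gcongr
        linarith
      have h4 : R ^ l ≤ (R + 1) ^ (l + 1) :=
        (pow_le_pow_left₀ hR (by linarith) l).trans
          (pow_le_pow_right₀ (by linarith) (Nat.le_succ l))
      have h5 : ‖((l : ℂ) + 1)‖ = (l : ℝ) + 1 := by
        have : ((l : ℂ) + 1) = ((l + 1 : ℝ) : ℂ) := by push_cast; ring
        rw [this, Complex.norm_real, Real.norm_eq_abs, abs_of_nonneg (by positivity)]
      calc ‖itoHermite (k + 1) (l + 1) z w‖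
          ≤ ‖w‖ * ‖itoHermite k (l + 1) z w‖ + ((l : ℝ) + 1) * ‖itoHermite k l z w‖ := by
            rw [itoHermite_succ_succ]
            refine (norm_sub_le _ _).trans ?_
            rw [norm_mul, norm_mul, h5]
        _ ≤ ‖w‖ * (D * (2 * (R + 1)) ^ (l + 1)) + 2 ^ (l + 1) * (D * (R + 1) ^ (l + 1)) := by
            gcongr
            · exact (h _).trans (by gcongr)
            · exact (h _).trans (by gcongr)
        _ = (‖w‖ * D + D) * (2 * (R + 1)) ^ (l + 1) := by
            rw [mul_pow]
            ring
        _ ≤ _ := by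
            have : 0 ≤ ‖w‖ ^ (k + 1) := by positivity
            refine mul_le_mul_of_nonneg_right ?_ (by positivity)
            linarith

lemma summable_itoHermite_mul (k m : ℕ) (z w : ℂ) :
    Summable fun l => conj (itoHermite m l z w) * itoHermite k l z w / (l.factorial : ℂ) := by
  obtain ⟨D, R, hD, hR, h⟩ := exists_norm_itoHermite_le k z w
  obtain ⟨D', R', hD', hR', h'⟩ := exists_norm_itoHermite_le m z w
  refine Summable.of_norm_bounded
    ((Real.summable_pow_div_factorial (R' * R)).mul_left (D' * D)) fun l => ?_
  rw [norm_div, norm_mul, RCLike.norm_conj, Complex.norm_natCast, mul_pow, ← mul_div_assoc]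
  refine div_le_div_of_nonneg_right ?_ (by positivity)
  calc _ ≤ (D' * R' ^ l) * (D * R ^ l) :=
        mul_le_mul (h' l) (h l) (norm_nonneg _) (by positivity)
    _ = _ := by ring

/-- The columns of a displacement operator have norm one. -/
lemma hasSum_itoHermite_norm_sq (k : ℕ) (z : ℂ) :
    HasSum (fun l => conj (itoHermite k l z (conj z)) * itoHermite k l z (conj z) /
      (l.factorial : ℂ)) ((k.factorial : ℂ) * Complex.exp (conj z * z)) := by
  induction k with
  | zero =>
    have h := NormedSpace.expSeries_div_hasSum_exp (conj z * z)
    rw [← Complex.exp_eq_exp_ℂ] at h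
    simpa [itoHermite_zero_left, mul_pow] using h
  | succ k ih =>
    set w := conj z with hw
    have s1 := (summable_itoHermite_mul k (k + 1) z w).mul_left w
    have s2 := summable_itoHermite_mul (k + 1) (k + 1) z w
    have s3 := s1.sub s2
    have s4 := ((summable_nat_add_iff 1).2 s3)
    -- The two recurrences, one in each index, rewrite the term at `l + 1` of `w * conj H_{k+1} *
    -- H_k - |H_{k+1}|²` through terms at `l`. The term at `0` vanishes, so summing makes the mixed
    -- series cancel and leaves the squared norm at `k + 1` as `k + 1` times that at `k`.
    have e : ∀ l : ℕ, w * (conj (itoHermite (k + 1) (l + 1) z w) * itoHermite k (l + 1) z w /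
          ((l + 1).factorial : ℂ)) -
        conj (itoHermite (k + 1) (l + 1) z w) * itoHermite (k + 1) (l + 1) z w /
          ((l + 1).factorial : ℂ) =
        w * (conj (itoHermite (k + 1) l z w) * itoHermite k l z w / (l.factorial : ℂ)) -
          (k + 1) * (conj (itoHermite k l z w) * itoHermite k l z w / (l.factorial : ℂ)) := by
      intro l
      rw [← mul_div_assoc, ← sub_div]
      have e1 : w * (conj (itoHermite (k + 1) (l + 1) z w) * itoHermite k (l + 1) z w) -
          conj (itoHermite (k + 1) (l + 1) z w) * itoHermite (k + 1) (l + 1) z w =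
          (l + 1) * (conj (itoHermite (k + 1) (l + 1) z w) * itoHermite k l z w) := by
        rw [itoHermite_succ_succ k l]
        ring
      have e2 : conj (itoHermite (k + 1) (l + 1) z w) =
          w * conj (itoHermite (k + 1) l z w) - (k + 1) * conj (itoHermite k l z w) := by
        rw [itoHermite_succ_right, map_sub, map_mul, map_mul, hw]
        simp
      rw [e1, e2, Nat.factorial_succ]
      have : ((l : ℂ) + 1) ≠ 0 := by exact_mod_cast Nat.succ_ne_zero l
      have : (l.factorial : ℂ) ≠ 0 := by exact_mod_cast l.factorial_ne_zero
      push_cast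
      field_simp
    have t1 := s3.tsum_eq_zero_add
    rw [tsum_congr e, s1.tsum_sub s2, s1.tsum_sub (ih.summable.mul_left _), tsum_mul_left (a := _ + 1),
      ih.tsum_eq] at t1
    have e0 : itoHermite (k + 1) 0 z w = w * itoHermite k 0 z w := by
      rw [itoHermite_zero_right, itoHermite_zero_right, pow_succ']
    rw [e0] at t1
    have t2 : ∑' l, conj (itoHermite (k + 1) l z w) * itoHermite (k + 1) l z w /
        (l.factorial : ℂ) = ((k + 1).factorial : ℂ) * Complex.exp (w * z) := by
      rw [Nat.factorial_succ]
      push_cast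
      linear_combination -t1
    rw [← t2]
    exact s2.hasSum

/-- A single nonnegative term of the column sum is at most the whole sum. -/
lemma norm_laguerre2D_le (k l : ℕ) (z : ℂ) :
    ‖laguerre2D k l z‖ ≤ Real.exp (‖z‖ ^ 2 / 2) := by
  have h := hasSum_itoHermite_norm_sq k z
  have e : ∀ l, conj (itoHermite k l z (conj z)) * itoHermite k l z (conj z) /
      (l.factorial : ℂ) = ((‖itoHermite k l z (conj z)‖ ^ 2 / l.factorial : ℝ) : ℂ) := by
    intro l
    rw [Complex.conj_mul']
    push_cast
    rfl
  have e' : (k.factorial : ℂ) * Complex.exp (conj z * z) =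
      ((k.factorial * Real.exp (‖z‖ ^ 2) : ℝ) : ℂ) := by
    rw [Complex.conj_mul']
    push_cast
    rfl
  simp only [e, e'] at h
  have h1 := le_hasSum (Complex.hasSum_ofReal.1 h) l fun _ _ => by positivity
  have hk : (0 : ℝ) < k.factorial := by positivity
  have hl : (0 : ℝ) < l.factorial := by positivity
  rw [div_le_iff₀ hl] at h1
  rw [laguerre2D_eq_itoHermite, norm_mul, Complex.norm_real, Real.norm_eq_abs,
    abs_of_nonneg (by positivity), one_div, ← Real.sqrt_mul hk.le, inv_mul_le_iff₀ (by positivity)]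
  refine (sq_le_sq₀ (norm_nonneg _) (by positivity)).1 ?_
  rw [mul_pow, Real.sq_sqrt (by positivity), ← Real.exp_nat_mul]
  calc _ ≤ _ := h1
    _ = _ := by
      push_cast
      rw [mul_div_cancel₀ _ (two_ne_zero' ℝ)]
      ring

/-! ### Uniform bounds on the estimators -/

lemma norm_sq_div_sqrt {η : ℝ} (hη : 0 < η) (z : ℂ) :
    ‖z‖ ^ 2 = η * ‖z / (Real.sqrt η : ℂ)‖ ^ 2 := by
  rw [norm_div, Complex.norm_real, Real.norm_eq_abs, div_pow, sq_abs, Real.sq_sqrt hη.le]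
  field_simp

lemma norm_fEst (k l : ℕ) {η : ℝ} (hη : 0 < η) (z : ℂ) :
    ‖fEst k l η z‖ = 1 / η ^ (1 + ((k : ℝ) + l) / 2) *
      (Real.exp ((η - 1) * ‖z / (Real.sqrt η : ℂ)‖ ^ 2) *
        ‖laguerre2D l k (z / (Real.sqrt η : ℂ))‖) := by
  have h1 : 0 < η ^ (1 + ((k : ℝ) + l) / 2) := Real.rpow_pos_of_pos hη _
  rw [fEst, norm_mul, Complex.norm_real, Real.norm_eq_abs, abs_of_nonneg (by positivity),
    norm_sq_div_sqrt hη z, mul_assoc]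
  congr 3
  field_simp

lemma exp_mul_norm_laguerre2D_le_one (k l : ℕ) {η : ℝ} (hη : η ≤ 1 / 2) (w : ℂ) :
    Real.exp ((η - 1) * ‖w‖ ^ 2) * ‖laguerre2D l k w‖ ≤ 1 := by
  calc _ ≤ Real.exp ((η - 1) * ‖w‖ ^ 2) * Real.exp (‖w‖ ^ 2 / 2) := by
        gcongr
        exact norm_laguerre2D_le _ _ _
    _ ≤ 1 := by
        rw [← Real.exp_add, Real.exp_le_one_iff]
        nlinarith [sq_nonneg ‖w‖]

lemma exp_mul_norm_le_sqrt_two {η : ℝ} (hη : η ≤ 2 / 3) (w : ℂ) :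
    Real.exp ((η - 1) * ‖w‖ ^ 2) * ‖w‖ ≤ Real.sqrt 2 := by
  refine Real.le_sqrt_of_sq_le ?_
  rw [mul_pow, ← Real.exp_nat_mul]
  have h0 := sq_nonneg ‖w‖
  have h : Real.exp ((2 : ℕ) * ((η - 1) * ‖w‖ ^ 2)) ≤ Real.exp (-(2 / 3 * ‖w‖ ^ 2)) := by
    apply Real.exp_le_exp.2
    push_cast
    nlinarith
  have h1 := Real.add_one_le_exp (2 / 3 * ‖w‖ ^ 2)
  calc _ ≤ Real.exp (-(2 / 3 * ‖w‖ ^ 2)) * (2 * Real.exp (2 / 3 * ‖w‖ ^ 2)) :=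
        mul_le_mul h (by linarith) h0 (Real.exp_pos _).le
    _ = 2 := by
        rw [mul_left_comm, ← Real.exp_add]
        simp

lemma exp_mul_abs_one_sub_le_one {η : ℝ} (hη : η ≤ 2 / 3) {x : ℝ} (hx : 0 ≤ x) :
    Real.exp ((η - 1) * x) * |1 - x| ≤ 1 := by
  have h1 : |1 - x| ≤ Real.exp (x / 3) := by
    have h := Real.quadratic_le_exp_of_nonneg (x := x / 3) (by positivity)
    rw [abs_le]
    constructor
    · nlinarith [sq_nonneg (x - 6)]
    · nlinarith
  calc _ ≤ Real.exp ((η - 1) * x) * Real.exp (x / 3) := by gcongr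
    _ ≤ 1 := by
        rw [← Real.exp_add, Real.exp_le_one_iff]
        nlinarith

lemma one_le_sqrt_two_pow_mul_choose (a b : ℕ) (h : b ≤ a) :
    1 ≤ Real.sqrt (2 ^ (a - b) * (a.choose b : ℝ)) := by
  rw [Real.one_le_sqrt]
  have h1 : (1 : ℝ) ≤ 2 ^ (a - b) := one_le_pow₀ (by norm_num)
  have h2 : (1 : ℝ) ≤ a.choose b := by exact_mod_cast Nat.choose_pos h
  nlinarith

/-- For `η ≤ 1 / 2` the Gaussian dominates the growth `exp (‖w‖² / 2)` and the left side is at most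
one. The upper bound on `η` allows `η > 1 / 2` only for `p = 1` and `c ≤ 2`, hence `j = 0`; the
polynomials left have moduli `1`, `‖w‖` and `|1 - ‖w‖²|`. For `c = 2` one has `η ≤ 2 / 3`, and `√2`
is the value of the right side at indices `0` and `1`. -/
lemma exp_mul_norm_laguerre2D_le {c p : ℕ} (hp : 0 < p) {η : ℝ} (hη1 : η < 1)
    (hη2 : η ≤ ((p : ℝ) + 1) / ((p : ℝ) * ((p : ℝ) + c))) {k l j : ℕ} (hk : k < c) (hl : l < c)
    (hj : j < p) (w : ℂ) :
    Real.exp ((η - 1) * ‖w‖ ^ 2) * ‖laguerre2D (l + j) (k + j) w‖ ≤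
      Real.sqrt (2 ^ (max k l - min k l) * ((max k l + j).choose (min k l + j) : ℝ)) := by
  have hone : 1 ≤
      Real.sqrt (2 ^ (max k l - min k l) * ((max k l + j).choose (min k l + j) : ℝ)) := by
    have := one_le_sqrt_two_pow_mul_choose (max k l + j) (min k l + j) (by omega)
    rwa [Nat.add_sub_add_right] at this
  rcases le_or_gt η (1 / 2) with h | h
  · exact (exp_mul_norm_laguerre2D_le_one _ _ h w).trans hone
  have hp' : (1 : ℝ) ≤ p := by exact_mod_cast hp
  have hc' : (1 : ℝ) ≤ c := by exact_mod_cast (show 1 ≤ c by omega)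
  have h3 : (p : ℝ) * (p + c) < 2 * (p + 1) := by
    have := h.trans_le hη2
    rw [lt_div_iff₀ (by positivity)] at this
    linarith
  have h4 : p * (p + c) < 2 * (p + 1) := by exact_mod_cast h3
  have hp1 : p = 1 := by
    by_contra hne
    have : 2 ≤ p := by omega
    nlinarith [show 1 ≤ c by omega]
  subst hp1
  have hj0 : j = 0 := by omega
  subst hj0
  have hc2 : c < 3 := by omega
  have h00 : ∀ w, ‖laguerre2D 0 0 w‖ = 1 := fun w => by simp [laguerre2D]
  have hle : Real.exp ((η - 1) * ‖w‖ ^ 2) ≤ 1 := by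
    rw [Real.exp_le_one_iff]
    nlinarith [sq_nonneg ‖w‖]
  rcases (show c = 1 ∨ c = 2 by omega) with hc | hc
  · subst hc
    obtain rfl : k = 0 := by omega
    obtain rfl : l = 0 := by omega
    refine le_trans ?_ hone
    rw [h00, mul_one]
    exact hle
  · subst hc
    have hη3 : η ≤ 2 / 3 := by
      refine hη2.trans (le_of_eq ?_)
      norm_num
    rcases (show k = 0 ∨ k = 1 by omega) with rfl | rfl <;>
      rcases (show l = 0 ∨ l = 1 by omega) with rfl | rfl
    · refine le_trans ?_ hone
      rw [h00, mul_one]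
      exact hle
    · simpa [laguerre2D] using exp_mul_norm_le_sqrt_two hη3 w
    · simpa [laguerre2D] using exp_mul_norm_le_sqrt_two hη3 w
    · have e : ‖laguerre2D 1 1 w‖ = |1 - ‖w‖ ^ 2| := by
        rw [abs_sub_comm, ← Real.norm_eq_abs, ← Complex.norm_real]
        congr 1
        simp only [laguerre2D, min_self, sum_range_succ, sum_range_zero]
        simp [Complex.mul_conj']
        ring
      refine le_trans ?_ hone
      rw [Nat.add_zero, e]
      exact exp_mul_abs_one_sub_le_one hη3 (sq_nonneg _)

/-- All dependence on `j` becomes a perfect square, so after taking roots the bound on the `j`-th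
term is a binomial coefficient times a factor free of `j`. -/
lemma choose_mul_choose_mul_choose (k d j : ℕ) :
    (k + j).choose k * (k + d + j).choose (k + d) * (k + d + j).choose (k + j) =
      (k + d + j).choose j ^ 2 * (k + d).choose k := by
  have h1 := Nat.add_choose_mul_factorial_mul_factorial k j
  have h2 := Nat.add_choose_mul_factorial_mul_factorial (k + d) j
  have h3 := Nat.add_choose_mul_factorial_mul_factorial (k + j) d
  have h4 := Nat.add_choose_mul_factorial_mul_factorial k d
  have h6 : (k + d + j).choose (k + j) = (k + d + j).choose d := by
    rw [show k + d + j = k + j + d by ring]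
    exact Nat.choose_symm_add
  rw [show k + j + d = k + d + j by ring] at h3
  rw [h6, Nat.choose_symm_add (a := k + d), Nat.choose_symm_add (a := k) (b := j),
    Nat.choose_symm_add (a := k) (b := d)]
  have : 0 < (k.factorial * j.factorial) * (d.factorial * (k + j).factorial) := by positivity
  refine Nat.eq_of_mul_eq_mul_left this ?_
  calc _ = ((k + j).choose j * k.factorial * j.factorial) * (k + d + j).choose j *
        ((k + d + j).choose d * (k + j).factorial * d.factorial) := by ring
    _ = (k + j).factorial * (k + d + j).choose j * ((k + d + j).choose j *
        ((k + d).choose d * k.factorial * d.factorial) * j.factorial) := by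
          rw [h1, h3, h4, h2]
    _ = _ := by ring

lemma choose_mul_choose_mul_choose_max_min (k l j : ℕ) :
    (k + j).choose k * (l + j).choose l * (max k l + j).choose (min k l + j) =
      (max k l + j).choose j ^ 2 * (max k l).choose (min k l) := by
  rcases le_total k l with h | h
  · obtain ⟨d, rfl⟩ := Nat.exists_eq_add_of_le h
    rw [max_eq_right h, min_eq_left h, choose_mul_choose_mul_choose]
  · obtain ⟨d, rfl⟩ := Nat.exists_eq_add_of_le h
    rw [max_eq_left h, min_eq_right h, mul_comm ((l + d + j).choose _),
      choose_mul_choose_mul_choose]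

/-- The hockey-stick identity, source of the binomial `C(max(k,l)+p, p-1)` in `constB`. -/
lemma sum_range_add_choose_self (m p : ℕ) :
    ∑ j ∈ range (p + 1), (m + j).choose j = (m + (p + 1)).choose p := by
  induction p with
  | zero => simp
  | succ p ih => rw [sum_range_succ, ih, ← add_assoc m (p + 1) 1, Nat.choose_succ_succ (m + (p + 1))]

/-- The weight `η ^ j` cancels the extra negative power of `η` in the `j`-th shifted estimator, so
every summand has the same order in `η`. -/
lemma norm_gEst_le {c p : ℕ} (hp : 0 < p) {η : ℝ} (hη : 0 < η) (hη1 : η < 1)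
    (hη2 : η ≤ ((p : ℝ) + 1) / ((p : ℝ) * ((p : ℝ) + c))) {k l : ℕ} (hk : k < c) (hl : l < c)
    (z : ℂ) :
    ‖gEst p k l η z‖ ≤ 1 / η ^ (1 + ((k : ℝ) + l) / 2) * ((max k l + p).choose (p - 1) : ℝ) *
      Real.sqrt (2 ^ (max k l - min k l) * ((max k l).choose (min k l) : ℝ)) := by
  obtain ⟨p, rfl⟩ := Nat.exists_eq_add_of_lt hp
  rw [zero_add] at *
  have hpow : 0 < η ^ (1 + ((k : ℝ) + l) / 2) := Real.rpow_pos_of_pos hη _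
  rw [Nat.add_sub_cancel, ← sum_range_add_choose_self, gEst, Nat.cast_sum, mul_sum, sum_mul]
  refine norm_sum_le_of_le _ fun j hj => ?_
  rw [mem_range] at hj
  have e1 : η ^ (1 + (((k + j : ℕ) : ℝ) + ((l + j : ℕ) : ℝ)) / 2) =
      η ^ (1 + ((k : ℝ) + l) / 2) * η ^ j := by
    rw [← Real.rpow_natCast η j, ← Real.rpow_add hη]
    congr 1
    push_cast
    ring
  have e2 : Real.sqrt (((k + j).choose k : ℝ) * ((l + j).choose l : ℝ)) *
      Real.sqrt (2 ^ (max k l - min k l) * ((max k l + j).choose (min k l + j) : ℝ)) =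
      ((max k l + j).choose j : ℝ) *
        Real.sqrt (2 ^ (max k l - min k l) * ((max k l).choose (min k l) : ℝ)) := by
    have h : ((max k l + j).choose j : ℝ) = Real.sqrt (((max k l + j).choose j : ℝ) ^ 2) :=
      (Real.sqrt_sq (by positivity)).symm
    rw [h, ← Real.sqrt_mul (by positivity), ← Real.sqrt_mul (by positivity)]
    congr 1
    have := choose_mul_choose_mul_choose_max_min k l j
    have h' : ((k + j).choose k : ℝ) * ((l + j).choose l : ℝ) *
        ((max k l + j).choose (min k l + j) : ℝ) =
      ((max k l + j).choose j : ℝ) ^ 2 * ((max k l).choose (min k l) : ℝ) := by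
      exact_mod_cast this
    linear_combination (2 : ℝ) ^ (max k l - min k l) * h'
  rw [norm_mul, norm_fEst _ _ hη, e1, Complex.norm_real, norm_mul, norm_mul, norm_pow, norm_pow,
    norm_neg, norm_one, one_pow, one_mul, Real.norm_of_nonneg hη.le,
    Real.norm_of_nonneg (Real.sqrt_nonneg _)]
  calc _ ≤ η ^ j * Real.sqrt (((k + j).choose k : ℝ) * ((l + j).choose l : ℝ)) *
        (1 / (η ^ (1 + ((k : ℝ) + l) / 2) * η ^ j) *
          Real.sqrt (2 ^ (max k l - min k l) * ((max k l + j).choose (min k l + j) : ℝ))) := by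
        gcongr
        exact exp_mul_norm_laguerre2D_le hp hη1 hη2 hk hl hj _
    _ = 1 / η ^ (1 + ((k : ℝ) + l) / 2) * (Real.sqrt (((k + j).choose k : ℝ) *
          ((l + j).choose l : ℝ)) * Real.sqrt (2 ^ (max k l - min k l) *
            ((max k l + j).choose (min k l + j) : ℝ))) := by
        field_simp
    _ = _ := by
        rw [e2]
        ring

lemma norm_gCore_le {c p : ℕ} (C : Fin c → ℂ) (hp : 0 < p) {η : ℝ} (hη : 0 < η) (hη1 : η < 1)
    (hη2 : η ≤ ((p : ℝ) + 1) / ((p : ℝ) * ((p : ℝ) + c))) (z : ℂ) :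
    ‖gCore C p η z‖ ≤ constB C p η / η ^ c := by
  rw [gCore, constB, sum_div]
  refine norm_sum_le_of_le _ fun k _ => ?_
  rw [sum_div]
  refine norm_sum_le_of_le _ fun l _ => ?_
  have e : η ^ ((c : ℝ) - 1 - (((k : ℕ) : ℝ) + ((l : ℕ) : ℝ)) / 2) / η ^ c =
      1 / η ^ (1 + (((k : ℕ) : ℝ) + ((l : ℕ) : ℝ)) / 2) := by
    rw [← Real.rpow_natCast η c, ← Real.rpow_sub hη, one_div, ← Real.rpow_neg hη.le]
    congr 1
    ring
  rw [norm_mul, norm_mul, RCLike.norm_conj, ← norm_mul]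
  refine (mul_le_mul_of_nonneg_left (norm_gEst_le hp hη hη1 hη2 k.2 l.2 z)
    (norm_nonneg _)).trans (le_of_eq ?_)
  rw [← e]
  ring

/-! ### An alternating binomial sum -/

lemma coeff_one_sub_X_pow (k q : ℕ) :
    PowerSeries.coeff q ((1 - PowerSeries.X : PowerSeries ℤ) ^ k) = (-1) ^ q * (k.choose q : ℤ) := by
  have h : ((1 - PowerSeries.X : PowerSeries ℤ) ^ k) =
      PowerSeries.evalNegHom (((1 + Polynomial.X) ^ k : Polynomial ℤ) : PowerSeries ℤ) := by
    simp [sub_eq_add_neg]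
  rw [h, PowerSeries.evalNegHom, PowerSeries.coeff_rescale, Polynomial.coeff_coe,
    Polynomial.coeff_one_add_X_pow]

/-- This is the coefficient of `X ^ l` in `(1 - X) ^ k * (1 - X) ^ (-(m + 1))`. For `k ≤ m` it is
read off a negative binomial series; otherwise the product is a polynomial of degree `k - m - 1 = l
- n - 1 < l`. -/
lemma sum_alternating_choose_mul_choose (k m l n : ℕ) (h : k + n = l + m) :
    ∑ q ∈ range (l + 1), (-1 : ℤ) ^ q * (k.choose q : ℤ) * ((m + (l - q)).choose m : ℤ) =
      if k ≤ m then (n.choose l : ℤ) else 0 := by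
  have h1 : ∑ q ∈ range (l + 1), (-1 : ℤ) ^ q * (k.choose q : ℤ) * ((m + (l - q)).choose m : ℤ) =
      PowerSeries.coeff l ((1 - PowerSeries.X : PowerSeries ℤ) ^ k *
        (PowerSeries.invOneSubPow ℤ (m + 1)).val) := by
    rw [PowerSeries.coeff_mul, Nat.sum_antidiagonal_eq_sum_range_succ_mk]
    refine sum_congr rfl fun q _ => ?_
    rw [coeff_one_sub_X_pow, PowerSeries.invOneSubPow_val_succ_eq_mk_add_choose,
      PowerSeries.coeff_mk]
  rw [h1]
  split_ifs with hk
  · obtain ⟨d, rfl⟩ := Nat.exists_eq_add_of_le hk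
    obtain rfl : n = d + l := by omega
    rw [show k + d + 1 = d + 1 + k by ring,
      PowerSeries.one_sub_pow_mul_invOneSubPow_val_add_eq_invOneSubPow_val,
      PowerSeries.invOneSubPow_val_succ_eq_mk_add_choose, PowerSeries.coeff_mk,
      Nat.choose_symm_add]
  · obtain ⟨d, rfl⟩ := Nat.exists_eq_add_of_lt (not_le.1 hk)
    rw [show m + d + 1 = d + (m + 1) by ring,
      PowerSeries.one_sub_pow_add_mul_invOneSubPow_val_eq_one_sub_pow, coeff_one_sub_X_pow,
      Nat.choose_eq_zero_of_lt (by omega)]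
    simp

/-! ### Gaussian moments -/

lemma integral_norm_pow_mul_exp (n : ℕ) {s : ℝ} (hs : 0 < s) :
    ∫ z : ℂ, ‖z‖ ^ n * Real.exp (-s * ‖z‖ ^ 2) =
      Real.pi * s ^ (-((n : ℝ) + 2) / 2) * Real.Gamma (((n : ℝ) + 2) / 2) := by
  have h := Complex.integral_rpow_mul_exp_neg_mul_rpow (p := 2) (q := n) one_le_two
    (by have : (0 : ℝ) ≤ n := by positivity
        linarith) hs
  simp only [Real.rpow_natCast, Real.rpow_ofNat] at h
  rw [h]
  ring

lemma integrable_norm_pow_mul_exp (n : ℕ) {s : ℝ} (hs : 0 < s) :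
    Integrable fun z : ℂ => ‖z‖ ^ n * Real.exp (-s * ‖z‖ ^ 2) := by
  -- The Bochner integral of a non-integrable function is zero, so the positive closed form already
  -- proves integrability.
  refine Integrable.of_integral_ne_zero ?_
  rw [integral_norm_pow_mul_exp n hs]
  have h1 : 0 < Real.Gamma (((n : ℝ) + 2) / 2) := Real.Gamma_pos_of_pos (by positivity)
  have h2 : 0 < s ^ (-((n : ℝ) + 2) / 2) := Real.rpow_pos_of_pos hs _
  positivity

lemma integrable_pow_mul_conj_pow_mul_exp (a b : ℕ) {s : ℝ} (hs : 0 < s) :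
    Integrable fun z : ℂ => z ^ a * conj z ^ b * (Real.exp (-s * ‖z‖ ^ 2) : ℂ) := by
  refine (integrable_norm_pow_mul_exp (a + b) hs).mono' ?_ (.of_forall fun z => le_of_eq ?_)
  · refine Continuous.aestronglyMeasurable ?_
    fun_prop
  · rw [norm_mul, norm_mul, norm_pow, norm_pow, RCLike.norm_conj, Complex.norm_real,
      Real.norm_of_nonneg (Real.exp_pos _).le, pow_add]

lemma integral_pow_mul_conj_pow_mul_exp (a b : ℕ) {s : ℝ} (hs : 0 < s) :
    ∫ z : ℂ, z ^ a * conj z ^ b * (Real.exp (-s * ‖z‖ ^ 2) : ℂ) =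
      if a = b then ((Real.pi * (a.factorial : ℝ) / s ^ (a + 1) : ℝ) : ℂ) else 0 := by
  split_ifs with h
  · subst h
    have e : ∀ z : ℂ, z ^ a * conj z ^ a * (Real.exp (-s * ‖z‖ ^ 2) : ℂ) =
        ((‖z‖ ^ (2 * a) * Real.exp (-s * ‖z‖ ^ 2) : ℝ) : ℂ) := by
      intro z
      rw [← mul_pow, Complex.mul_conj']
      push_cast
      rw [pow_mul]
    simp only [e]
    rw [integral_complex_ofReal, integral_norm_pow_mul_exp _ hs]
    congr 1
    have e1 : (((2 * a : ℕ) : ℝ) + 2) / 2 = (a : ℝ) + 1 := by push_cast; ring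
    rw [neg_div, e1, Real.Gamma_nat_eq_factorial, Real.rpow_neg hs.le]
    have e2 : s ^ ((a : ℝ) + 1) = s ^ (a + 1) := by
      rw [← Real.rpow_natCast]
      push_cast
      rfl
    rw [e2]
    field_simp
  · have hne : ((a : ℂ) - b) ≠ 0 := by
      rw [sub_ne_zero]
      exact_mod_cast h
    -- Rotation by the angle `π / (a - b)` preserves the measure and changes the sign of the
    -- integrand, so the integral equals its own negative.
    let u : Circle := Circle.exp (Real.pi / ((a : ℝ) - b))
    have hu : (u : ℂ) ^ a * conj (u : ℂ) ^ b = -1 := by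
      rw [Circle.coe_exp, ← Complex.exp_conj, ← Complex.exp_nat_mul, ← Complex.exp_nat_mul,
        ← Complex.exp_add, ← Complex.exp_pi_mul_I]
      congr 1
      simp only [map_mul, Complex.conj_ofReal, Complex.conj_I]
      push_cast
      field_simp
      ring
    have h1 := (rotation u).measurePreserving.integral_comp
      (rotation u).toHomeomorph.measurableEmbedding
      (fun z : ℂ => z ^ a * conj z ^ b * (Real.exp (-s * ‖z‖ ^ 2) : ℂ))
    have e : ∀ z : ℂ, (rotation u z) ^ a * conj (rotation u z) ^ b *
        (Real.exp (-s * ‖rotation u z‖ ^ 2) : ℂ) =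
        (-1) * (z ^ a * conj z ^ b * (Real.exp (-s * ‖z‖ ^ 2) : ℂ)) := by
      intro z
      rw [LinearIsometryEquiv.norm_map, rotation_apply, map_mul, mul_pow, mul_pow, ← hu]
      ring
    simp only [e] at h1
    rw [integral_const_mul] at h1
    have h2 : (2 : ℂ) * ∫ z : ℂ, z ^ a * conj z ^ b * (Real.exp (-s * ‖z‖ ^ 2) : ℂ) = 0 := by
      linear_combination -h1
    simpa using h2

/-! ### Expansion of the Husimi function in the Fock basis -/

lemma hasSum_iff_of_forall_eq {ι : Type*} {f g : ι → ℂ} {a : ℂ} (h : ∀ i, f i = g i) :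
    HasSum f a ↔ HasSum g a := by
  rw [funext h]

/-- The matrix element `⟨m|ρ|n⟩`. -/
noncomputable def DensityOperator.elem (ρ : DensityOperator ℕ) (m n : ℕ) : ℂ :=
  inner ℂ (ket m) (ρ.op (ket n))

lemma ket_apply {ι : Type} [DecidableEq ι] (i j : ι) :
    (ket i : FockSpace ι) j = if j = i then 1 else 0 := by
  have e : (ket i : FockSpace ι) = lp.single 2 i (1 : ℂ) := by
    unfold ket
    congr
    exact Subsingleton.elim _ _
  rw [e, lp.single_apply]
  split_ifs with h
  · subst h
    simp
  · simp [h]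

lemma norm_ket {ι : Type} (i : ι) : ‖(ket i : FockSpace ι)‖ = 1 := by
  classical
  have h := inner_ket_left i (ket i)
  rw [ket_apply, if_pos rfl] at h
  have h' : ‖(ket i : FockSpace ι)‖ ^ 2 = 1 := by
    rw [norm_sq_eq_re_inner (𝕜 := ℂ), h]
    simp
  exact (pow_eq_one_iff_of_nonneg (norm_nonneg _) two_ne_zero).1 h'

lemma hasSum_smul_ket {ι : Type} (x : FockSpace ι) : HasSum (fun n => x n • ket n) x := by
  classical
  have e : ∀ n, x n • ket n = lp.single 2 n (x n) := by
    intro n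
    ext i
    rw [lp.coeFn_smul, Pi.smul_apply, ket_apply, lp.single_apply]
    by_cases h : i = n
    · subst h
      simp
    · simp [h]
  simp only [e]
  exact lp.hasSum_single (by simp) x

lemma DensityOperator.norm_elem_le (ρ : DensityOperator ℕ) (m n : ℕ) : ‖ρ.elem m n‖ ≤ ‖ρ.op‖ := by
  calc _ ≤ ‖(ket m : FockSpace ℕ)‖ * ‖ρ.op (ket n)‖ := norm_inner_le_norm _ _
    _ ≤ ‖(ket m : FockSpace ℕ)‖ * (‖ρ.op‖ * ‖(ket n : FockSpace ℕ)‖) := by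
        gcongr
        exact ρ.op.le_opNorm _
    _ = _ := by rw [norm_ket, norm_ket, one_mul, mul_one]

lemma DensityOperator.hasSum_elem (ρ : DensityOperator ℕ) (x : FockSpace ℕ)
    (hx : Summable fun n => ‖x n‖) :
    HasSum (fun mn : ℕ × ℕ => conj (x mn.1) * x mn.2 * ρ.elem mn.1 mn.2)
      (inner ℂ x (ρ.op x)) := by
  have hs : Summable (fun mn : ℕ × ℕ => conj (x mn.1) * x mn.2 * ρ.elem mn.1 mn.2) := by
    refine Summable.of_norm_bounded ((hx.mul_of_nonneg hx (fun _ => norm_nonneg _)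
      (fun _ => norm_nonneg _)).mul_right ‖ρ.op‖) fun mn => ?_
    rw [norm_mul, norm_mul, RCLike.norm_conj]
    gcongr
    exact ρ.norm_elem_le _ _
  have h1 : ∀ m, HasSum (fun n => conj (x m) * x n * ρ.elem m n)
      (conj (x m) * (ρ.op x) m) := by
    intro m
    have h := (((hasSum_smul_ket x).mapL ρ.op).mapL (innerSL ℂ (ket m))).mul_left (conj (x m))
    simp only [innerSL_apply_apply, inner_ket_left] at h
    refine (hasSum_iff_of_forall_eq fun n => ?_).2 h
    rw [DensityOperator.elem, inner_ket_left, map_smul, lp.coeFn_smul, Pi.smul_apply, smul_eq_mul]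
    ring
  have h2 := hs.hasSum.prod_fiberwise h1
  have h3 : HasSum (fun m => conj (x m) * (ρ.op x) m) (inner ℂ x (ρ.op x)) := by
    have := lp.hasSum_inner (𝕜 := ℂ) x (ρ.op x)
    simpa [RCLike.inner_apply, mul_comm] using this
  rw [h3.unique h2]
  exact hs.hasSum

lemma coherent_apply (z : ℂ) (n : ℕ) : coherent z n =
    (Real.exp (-‖z‖ ^ 2 / 2) : ℂ) * (z ^ n / (Real.sqrt (n.factorial : ℝ) : ℂ)) := rfl

/-- For `t > 1` this trades Gaussian growth in `z` for geometric decay in `n`, the form needed for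
dominated summation. -/
lemma norm_pow_div_sqrt_factorial_le {t : ℝ} (ht : 0 < t) (z : ℂ) (n : ℕ) :
    ‖z‖ ^ n / Real.sqrt (n.factorial : ℝ) ≤
      (1 / Real.sqrt t) ^ n * Real.exp (t / 2 * ‖z‖ ^ 2) := by
  have h := Real.pow_div_factorial_le_exp (t * ‖z‖ ^ 2) (by positivity) n
  have h1 : ‖z‖ ^ n / Real.sqrt (n.factorial : ℝ) * Real.sqrt t ^ n ≤
      Real.exp (t / 2 * ‖z‖ ^ 2) := by
    refine (sq_le_sq₀ (by positivity) (by positivity)).1 ?_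
    rw [mul_pow, div_pow, Real.sq_sqrt (by positivity), ← pow_mul, ← pow_mul, ← Real.exp_nat_mul,
      mul_comm n 2, pow_mul, pow_mul, Real.sq_sqrt ht.le]
    refine le_trans (le_of_eq ?_) (h.trans (le_of_eq ?_))
    · rw [mul_pow]
      ring
    · congr 1
      push_cast
      ring
  have h2 : 0 < Real.sqrt t ^ n := by positivity
  rw [one_div, inv_pow, inv_mul_eq_div, le_div_iff₀ h2]
  exact h1

lemma summable_norm_coherent (z : ℂ) : Summable fun n => ‖coherent z n‖ := by
  have hr : 1 / Real.sqrt 2 < 1 := by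
    rw [div_lt_one (by positivity), Real.lt_sqrt zero_le_one]
    norm_num
  refine Summable.of_nonneg_of_le (fun _ => norm_nonneg _) (fun n => ?_)
    (((summable_geometric_of_lt_one (by positivity) hr).mul_right
      (Real.exp (2 / 2 * ‖z‖ ^ 2))).mul_left (Real.exp (-‖z‖ ^ 2 / 2)))
  rw [coherent_apply, norm_mul, norm_div, norm_pow, Complex.norm_real, Complex.norm_real,
    Real.norm_of_nonneg (Real.exp_pos _).le, Real.norm_of_nonneg (Real.sqrt_nonneg _)]
  exact mul_le_mul_of_nonneg_left (norm_pow_div_sqrt_factorial_le two_pos z n) (Real.exp_pos _).le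

/-- A pointwise limit of the finite partial sums of the Fock expansion, each continuous in `z`. -/
lemma measurable_inner_coherent (ρ : DensityOperator ℕ) :
    Measurable fun z : ℂ => inner ℂ (coherent z) (ρ.op (coherent z)) := by
  refine measurable_of_tendsto_metrizable' Filter.atTop
    (f := fun (t : Finset (ℕ × ℕ)) z => ∑ mn ∈ t, conj (coherent z mn.1) * coherent z mn.2 *
      ρ.elem mn.1 mn.2) (fun t => Finset.measurable_fun_sum _ fun mn _ => ?_)
    (tendsto_pi_nhds.2 fun z => ?_)
  · simp only [coherent_apply]
    refine Continuous.measurable ?_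
    fun_prop
  · have h := ρ.hasSum_elem _ (summable_norm_coherent z)
    rwa [HasSum, SummationFilter.unconditional_filter] at h

lemma hasSum_integral_monomial (ρ : DensityOperator ℕ) (a b : ℕ) {s : ℝ} (hs : 1 < s) :
    Integrable (fun z : ℂ => z ^ a * conj z ^ b * (Real.exp ((1 - s) * ‖z‖ ^ 2) : ℂ) *
      ((1 / Real.pi : ℝ) * inner ℂ (coherent z) (ρ.op (coherent z)))) ∧
    HasSum (fun mn : ℕ × ℕ => ρ.elem mn.1 mn.2 *
      ((1 / (Real.sqrt (mn.1.factorial : ℝ) * Real.sqrt (mn.2.factorial : ℝ)) *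
        (if a + mn.2 = b + mn.1 then ((a + mn.2).factorial : ℝ) / s ^ (a + mn.2 + 1) else 0) : ℝ)
          : ℂ))
      (∫ z : ℂ, z ^ a * conj z ^ b * (Real.exp ((1 - s) * ‖z‖ ^ 2) : ℂ) *
        ((1 / Real.pi : ℝ) * inner ℂ (coherent z) (ρ.op (coherent z)))) := by
  have hs0 : 0 < s := one_pos.trans hs
  -- Any `t` strictly between `1` and `s` works: `t > 1` makes the double series geometric, and `t <
  -- s` leaves a decaying Gaussian as majorant.
  set t : ℝ := (1 + s) / 2 with ht
  have ht1 : 1 < t := by linarith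
  have hts : 0 < s - t := by linarith
  set r : ℝ := 1 / Real.sqrt t with hr
  have hr0 : 0 ≤ r := by positivity
  have hr1 : r < 1 := by
    rw [hr, div_lt_one (by positivity), Real.lt_sqrt zero_le_one]
    linarith
  let F : ℕ × ℕ → ℂ → ℂ := fun mn z =>
    ρ.elem mn.1 mn.2 *
      ((1 / Real.pi / (Real.sqrt (mn.1.factorial : ℝ) * Real.sqrt (mn.2.factorial : ℝ)) : ℝ) : ℂ) *
      (z ^ (a + mn.2) * conj z ^ (b + mn.1) * (Real.exp (-s * ‖z‖ ^ 2) : ℂ))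
  have hF : ∀ z, HasSum (fun mn => F mn z) (z ^ a * conj z ^ b *
      (Real.exp ((1 - s) * ‖z‖ ^ 2) : ℂ) *
        ((1 / Real.pi : ℝ) * inner ℂ (coherent z) (ρ.op (coherent z)))) := by
    intro z
    have h := ((ρ.hasSum_elem _ (summable_norm_coherent z)).mul_left
      ((1 / Real.pi : ℝ) : ℂ)).mul_left
      (z ^ a * conj z ^ b * (Real.exp ((1 - s) * ‖z‖ ^ 2) : ℂ))
    refine (hasSum_iff_of_forall_eq fun mn => ?_).2 h
    have e : Real.exp (-s * ‖z‖ ^ 2) = Real.exp ((1 - s) * ‖z‖ ^ 2) *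
        (Real.exp (-‖z‖ ^ 2 / 2) * Real.exp (-‖z‖ ^ 2 / 2)) := by
      rw [← Real.exp_add, ← Real.exp_add]
      congr 1
      ring
    simp only [F, e, coherent_apply, map_mul, map_div₀, map_pow, Complex.conj_ofReal]
    rw [pow_add, pow_add]
    push_cast
    ring
  have hint : ∀ mn, Integrable (F mn) := fun mn =>
    (integrable_pow_mul_conj_pow_mul_exp _ _ hs0).const_mul _
  let G : ℂ → ℝ := fun z => ‖ρ.op‖ * (1 / Real.pi) *
    (‖z‖ ^ (a + b) * Real.exp (-(s - t) * ‖z‖ ^ 2))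
  have hG : Integrable G := (integrable_norm_pow_mul_exp _ hts).const_mul _
  have hFG : ∀ mn z, ‖F mn z‖ ≤ r ^ mn.1 * r ^ mn.2 * G z := by
    intro mn z
    have e : Real.exp (-(s - t) * ‖z‖ ^ 2) = Real.exp (-s * ‖z‖ ^ 2) *
        (Real.exp (t / 2 * ‖z‖ ^ 2) * Real.exp (t / 2 * ‖z‖ ^ 2)) := by
      rw [← Real.exp_add, ← Real.exp_add]
      congr 1
      ring
    calc ‖F mn z‖ = ‖ρ.elem mn.1 mn.2‖ * (1 / Real.pi) * (‖z‖ ^ (a + b) *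
          Real.exp (-s * ‖z‖ ^ 2)) * ((‖z‖ ^ mn.1 / Real.sqrt (mn.1.factorial : ℝ)) *
            (‖z‖ ^ mn.2 / Real.sqrt (mn.2.factorial : ℝ))) := by
          simp only [F]
          rw [norm_mul, norm_mul, norm_mul, norm_mul, norm_pow, norm_pow, RCLike.norm_conj,
            Complex.norm_real, Complex.norm_real, Real.norm_of_nonneg (by positivity),
            Real.norm_of_nonneg (Real.exp_pos _).le, pow_add, pow_add, pow_add]
          ring
      _ ≤ ‖ρ.op‖ * (1 / Real.pi) * (‖z‖ ^ (a + b) * Real.exp (-s * ‖z‖ ^ 2)) *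
          ((r ^ mn.1 * Real.exp (t / 2 * ‖z‖ ^ 2)) * (r ^ mn.2 * Real.exp (t / 2 * ‖z‖ ^ 2))) := by
          gcongr
          · exact ρ.norm_elem_le _ _
          · exact norm_pow_div_sqrt_factorial_le (by linarith) z _
          · exact norm_pow_div_sqrt_factorial_le (by linarith) z _
      _ = _ := by
          simp only [G]
          rw [e]
          ring
  have hgeo := summable_geometric_of_lt_one hr0 hr1
  have hgeo2 := hgeo.mul_of_nonneg hgeo (fun _ => by positivity) (fun _ => by positivity)
  refine ⟨(hG.const_mul (∑' mn : ℕ × ℕ, r ^ mn.1 * r ^ mn.2)).mono'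
    (Measurable.aestronglyMeasurable ?_) (.of_forall fun z => (hF z).norm_le_of_bounded
      (hgeo2.hasSum.mul_right (G z)) fun mn => hFG mn z), ?_⟩
  · refine Measurable.mul (Continuous.measurable (by fun_prop)) ?_
    exact (measurable_inner_coherent ρ).const_mul _
  have hsum : Summable fun mn => ∫ z, ‖F mn z‖ := by
    refine Summable.of_nonneg_of_le (fun _ => integral_nonneg fun _ => norm_nonneg _) (fun mn => ?_)
      (hgeo2.mul_right (∫ z, G z))
    rw [← integral_const_mul]
    exact integral_mono (hint mn).norm (hG.const_mul _) (hFG mn)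
  have h := hasSum_integral_of_summable_integral_norm hint hsum
  simp only [fun z => (hF z).tsum_eq] at h
  refine (hasSum_iff_of_forall_eq fun mn => ?_).2 h
  simp only [F]
  rw [integral_const_mul, integral_pow_mul_conj_pow_mul_exp _ _ hs0]
  have hpi : (Real.pi : ℂ) ≠ 0 := by exact_mod_cast Real.pi_ne_zero
  split_ifs with hab
  · push_cast
    field_simp
  · simp

/-! ### Expectation of the elementary estimators -/

/-- The coefficient of `z ^ (k - q) * conj z ^ (l - q) * exp ((1 - 1 / η) * |z| ^ 2)` in the
estimator `f_{k,l}(z, η)`. -/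
noncomputable def fCoeff (k l q : ℕ) (η : ℝ) : ℝ :=
  η ^ q / η ^ (1 + k + l) * (1 / (Real.sqrt (l.factorial : ℝ) * Real.sqrt (k.factorial : ℝ))) *
    ((-1) ^ q * (q.factorial : ℝ) * (l.choose q : ℝ) * (k.choose q : ℝ))

lemma fEst_eq_sum (k l : ℕ) {η : ℝ} (hη : 0 < η) (z : ℂ) :
    fEst k l η z = ∑ q ∈ range (l + 1), (fCoeff k l q η : ℂ) *
      (z ^ (k - q) * conj z ^ (l - q) * (Real.exp ((1 - 1 / η) * ‖z‖ ^ 2) : ℂ)) := by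
  rw [fEst, laguerre2D_eq_itoHermite, itoHermite, mul_sum, mul_sum]
  refine sum_congr rfl fun q hq => ?_
  rw [mem_range] at hq
  rcases lt_or_ge k q with h | h
  · simp [fCoeff, Nat.choose_eq_zero_of_lt h]
  have e : 1 / η ^ (1 + ((k : ℝ) + l) / 2) = η ^ q / η ^ (1 + k + l) *
      (Real.sqrt η ^ (k - q) * Real.sqrt η ^ (l - q)) := by
    rw [Real.sqrt_eq_rpow, ← Real.rpow_natCast (η ^ _), ← Real.rpow_natCast (η ^ _),
      ← Real.rpow_mul hη.le, ← Real.rpow_mul hη.le, ← Real.rpow_natCast, ← Real.rpow_natCast,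
      ← Real.rpow_sub hη, ← Real.rpow_add hη, ← Real.rpow_add hη, one_div, ← Real.rpow_neg hη.le]
    congr 1
    rw [Nat.cast_sub h, Nat.cast_sub (by omega)]
    push_cast
    ring
  have hs : (Real.sqrt η : ℂ) ≠ 0 := by exact_mod_cast (Real.sqrt_pos.2 hη).ne'
  have h1 : (Real.sqrt η : ℂ) ^ (k - q) * ((z ^ (k - q)) / (Real.sqrt η : ℂ) ^ (k - q)) =
      z ^ (k - q) := mul_div_cancel₀ _ (pow_ne_zero _ hs)
  have h2 : (Real.sqrt η : ℂ) ^ (l - q) * ((conj z ^ (l - q)) / (Real.sqrt η : ℂ) ^ (l - q)) =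
      conj z ^ (l - q) := mul_div_cancel₀ _ (pow_ne_zero _ hs)
  rw [e, fCoeff, map_div₀, Complex.conj_ofReal, div_pow, div_pow]
  conv_rhs => rw [← h1, ← h2]
  generalize (1 - 1 / η) * ‖z‖ ^ 2 = x
  generalize z ^ (k - q) / (Real.sqrt η : ℂ) ^ (k - q) = x1
  generalize conj z ^ (l - q) / (Real.sqrt η : ℂ) ^ (l - q) = x2
  push_cast
  ring

/-- Each monomial of `fEst` contributes a Gaussian moment at `s = 1 / η`. After the factorials are
regrouped, the sum over `q` is the alternating binomial sum, which removes the matrix elements with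
`m < k`. -/
lemma sum_fCoeff (k l m n : ℕ) {η : ℝ} (hη : 0 < η) :
    ∑ q ∈ range (l + 1), fCoeff k l q η *
      (1 / (Real.sqrt (m.factorial : ℝ) * Real.sqrt (n.factorial : ℝ)) *
        (if k - q + n = l - q + m then
          ((k - q + n).factorial : ℝ) / (1 / η) ^ (k - q + n + 1) else 0)) =
      if k + n = l + m ∧ k ≤ m then
        η ^ (m - k) * Real.sqrt ((m.choose k : ℝ) * (n.choose l : ℝ)) else 0 := by
  by_cases h : k + n = l + m
  swap
  · rw [if_neg (fun h' => h h'.1)]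
    refine sum_eq_zero fun q hq => ?_
    rw [mem_range] at hq
    rcases lt_or_ge k q with hk | hk
    · simp [fCoeff, Nat.choose_eq_zero_of_lt hk]
    · rw [if_neg (by omega)]
      simp
  set D : ℝ := Real.sqrt (l.factorial : ℝ) * Real.sqrt (k.factorial : ℝ) *
    (Real.sqrt (m.factorial : ℝ) * Real.sqrt (n.factorial : ℝ)) with hD
  have hD0 : 0 < D := by positivity
  have h1 : ∀ q ∈ range (l + 1), fCoeff k l q η *
      (1 / (Real.sqrt (m.factorial : ℝ) * Real.sqrt (n.factorial : ℝ)) *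
        (if k - q + n = l - q + m then
          ((k - q + n).factorial : ℝ) / (1 / η) ^ (k - q + n + 1) else 0)) =
      η ^ n / η ^ l / D * (l.factorial * m.factorial) *
        (((-1 : ℤ) ^ q * (k.choose q : ℤ) * ((m + (l - q)).choose m : ℤ) : ℤ) : ℝ) := by
    intro q hq
    rw [mem_range] at hq
    rcases lt_or_ge k q with hk | hk
    · simp [fCoeff, Nat.choose_eq_zero_of_lt hk]
    have hl : q ≤ l := by omega
    have e1 : k - q + n = m + (l - q) := by omega
    have e2 : (m + (l - q)).factorial = (m + (l - q)).choose m * m.factorial * (l - q).factorial := by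
      rw [Nat.choose_symm_add, Nat.add_choose_mul_factorial_mul_factorial]
    have e3 : (l.choose q : ℝ) * q.factorial * (l - q).factorial = l.factorial := by
      exact_mod_cast Nat.choose_mul_factorial_mul_factorial hl
    have e4 : η ^ q / η ^ (1 + k + l) * η ^ (k - q + n + 1) = η ^ n / η ^ l := by
      rw [div_mul_eq_mul_div, ← pow_add, div_eq_div_iff (by positivity) (by positivity), ← pow_add,
        ← pow_add]
      congr 1
      omega
    rw [if_pos (by omega), ← e4, ← e3, one_div η, inv_pow, div_inv_eq_mul, fCoeff]
    rw [show ((k - q + n).factorial : ℝ) = ((m + (l - q)).choose m : ℝ) * m.factorial *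
      (l - q).factorial by rw [e1, e2]; push_cast; ring]
    rw [hD]
    push_cast
    field_simp
  rw [sum_congr rfl h1, ← mul_sum, ← Int.cast_sum, sum_alternating_choose_mul_choose k m l n h]
  by_cases hk : k ≤ m
  swap
  · rw [if_neg hk, if_neg (fun h' => hk h'.2)]
    simp
  rw [if_pos hk, if_pos ⟨h, hk⟩]
  obtain ⟨j, rfl⟩ := Nat.exists_eq_add_of_le hk
  obtain rfl : n = l + j := by omega
  have e5 : ∀ a : ℕ, ((a + j).choose a : ℝ) = ((a + j).factorial : ℝ) /
      ((a.factorial : ℝ) * j.factorial) := fun a => Nat.cast_add_choose ℝ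
  have e6 : Real.sqrt (((k + j).choose k : ℝ) * ((l + j).choose l : ℝ)) =
      Real.sqrt ((k + j).factorial : ℝ) * Real.sqrt ((l + j).factorial : ℝ) /
        (Real.sqrt (k.factorial : ℝ) * Real.sqrt (l.factorial : ℝ) * j.factorial) := by
    have hj : (j.factorial : ℝ) = Real.sqrt ((j.factorial : ℝ) ^ 2) :=
      (Real.sqrt_sq (by positivity)).symm
    rw [e5, e5, hj, ← Real.sqrt_mul (by positivity), ← Real.sqrt_mul (by positivity),
      ← Real.sqrt_mul (by positivity), ← Real.sqrt_div (by positivity), ← hj]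
    congr 1
    field_simp
  rw [e6, Nat.add_sub_cancel_left, Int.cast_natCast, e5, hD]
  have s1 := Real.sq_sqrt (show (0 : ℝ) ≤ ((k + j).factorial : ℝ) by positivity)
  have s2 := Real.sq_sqrt (show (0 : ℝ) ≤ ((l + j).factorial : ℝ) by positivity)
  have e7 : η ^ (l + j) / η ^ l = η ^ j := by
    rw [pow_add]
    field_simp
  rw [e7]
  have p1 : 0 < Real.sqrt ((k + j).factorial : ℝ) := by positivity
  have p2 : 0 < Real.sqrt ((l + j).factorial : ℝ) := by positivity
  field_simp
  rw [s1, s2]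

/-- The surviving pairs are exactly the image of the injection `j ↦ (k + j, l + j)`, so the double
series collapses to a power series in `η` with constant term `ρ.elem k l`. -/
lemma hasSum_integral_fEst (ρ : DensityOperator ℕ) (k l : ℕ) {η : ℝ} (hη : 0 < η) (hη1 : η < 1) :
    Integrable (fun z : ℂ => fEst k l η z *
      ((1 / Real.pi : ℝ) * inner ℂ (coherent z) (ρ.op (coherent z)))) ∧
    HasSum (fun j : ℕ => ρ.elem (k + j) (l + j) *
      ((η ^ j * Real.sqrt (((k + j).choose k : ℝ) * ((l + j).choose l : ℝ)) : ℝ) : ℂ))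
      (∫ z : ℂ, fEst k l η z *
        ((1 / Real.pi : ℝ) * inner ℂ (coherent z) (ρ.op (coherent z)))) := by
  have hs : 1 < 1 / η := by rwa [lt_div_iff₀ hη, one_mul]
  have hmon := fun a b => hasSum_integral_monomial ρ a b hs
  have e : ∀ z : ℂ, fEst k l η z *
      ((1 / Real.pi : ℝ) * inner ℂ (coherent z) (ρ.op (coherent z))) =
      ∑ q ∈ range (l + 1), (fCoeff k l q η : ℂ) *
        (z ^ (k - q) * conj z ^ (l - q) * (Real.exp ((1 - 1 / η) * ‖z‖ ^ 2) : ℂ) *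
          ((1 / Real.pi : ℝ) * inner ℂ (coherent z) (ρ.op (coherent z)))) := by
    intro z
    rw [fEst_eq_sum k l hη, sum_mul]
    exact sum_congr rfl fun q _ => mul_assoc _ _ _
  simp only [e]
  have hi : ∀ q ∈ range (l + 1), Integrable fun z : ℂ => (fCoeff k l q η : ℂ) *
        (z ^ (k - q) * conj z ^ (l - q) * (Real.exp ((1 - 1 / η) * ‖z‖ ^ 2) : ℂ) *
          ((1 / Real.pi : ℝ) * inner ℂ (coherent z) (ρ.op (coherent z)))) :=
    fun q _ => (hmon _ _).1.const_mul _
  refine ⟨integrable_finsetSum _ hi, ?_⟩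
  rw [integral_finsetSum _ hi]
  simp only [integral_const_mul]
  have h := hasSum_sum (s := range (l + 1)) fun q _ =>
    ((hmon (k - q) (l - q)).2.mul_left (fCoeff k l q η : ℂ))
  have h' := (hasSum_iff_of_forall_eq (g := fun mn : ℕ × ℕ => ρ.elem mn.1 mn.2 *
    ((if k + mn.2 = l + mn.1 ∧ k ≤ mn.1 then η ^ (mn.1 - k) *
      Real.sqrt ((mn.1.choose k : ℝ) * (mn.2.choose l : ℝ)) else 0 : ℝ) : ℂ))
    fun mn => by
      rw [← sum_fCoeff k l mn.1 mn.2 hη, Complex.ofReal_sum, mul_sum]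
      refine sum_congr rfl fun q _ => ?_
      rw [Complex.ofReal_mul (fCoeff k l q η)]
      exact mul_left_comm _ _ _).1 h
  have hinj : Function.Injective fun j : ℕ => (k + j, l + j) := fun i j hij => by
    simpa using hij
  rw [← hinj.hasSum_iff] at h'
  · refine (hasSum_iff_of_forall_eq fun j => ?_).1 h'
    simp only [Function.comp]
    rw [if_pos (by omega), Nat.add_sub_cancel_left]
  · intro mn hmn
    rw [if_neg]
    · simp
    · rintro ⟨h1, h2⟩
      refine hmn ⟨mn.1 - k, ?_⟩
      ext <;> simp <;> omega

/-! ### The heterodyne law is a probability measure -/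

lemma DensityOperator.exists_inner_eq_norm_sq (ρ : DensityOperator ℕ) :
    ∃ S : FockSpace ℕ →L[ℂ] FockSpace ℕ, ∀ x, inner ℂ x (ρ.op x) = ((‖S x‖ ^ 2 : ℝ) : ℂ) := by
  obtain ⟨S, hS⟩ := exists_sqrt ρ.op ρ.isPositive
  refine ⟨S, fun x => ?_⟩
  rw [← hS, inner_self_eq_norm_sq_to_K, Complex.ofReal_pow]
  rfl

lemma DensityOperator.re_inner_nonneg (ρ : DensityOperator ℕ) (x : FockSpace ℕ) :
    0 ≤ (inner ℂ x (ρ.op x)).re := by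
  obtain ⟨S, hS⟩ := ρ.exists_inner_eq_norm_sq
  rw [hS, Complex.ofReal_re]
  positivity

lemma DensityOperator.ofReal_re_inner (ρ : DensityOperator ℕ) (x : FockSpace ℕ) :
    (((inner ℂ x (ρ.op x)).re : ℝ) : ℂ) = inner ℂ x (ρ.op x) := by
  obtain ⟨S, hS⟩ := ρ.exists_inner_eq_norm_sq
  rw [hS, Complex.ofReal_re]

lemma husimiQ_nonneg (ρ : DensityOperator ℕ) (z : ℂ) : 0 ≤ husimiQ ρ z :=
  mul_nonneg (by positivity) (ρ.re_inner_nonneg _)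

lemma ofReal_husimiQ (ρ : DensityOperator ℕ) (z : ℂ) :
    (husimiQ ρ z : ℂ) = (1 / Real.pi : ℝ) * inner ℂ (coherent z) (ρ.op (coherent z)) := by
  rw [husimiQ, Complex.ofReal_mul, ρ.ofReal_re_inner]

lemma measurable_husimiQ (ρ : DensityOperator ℕ) : Measurable (husimiQ ρ) :=
  (Complex.measurable_re.comp (measurable_inner_coherent ρ)).const_mul _

lemma integral_heterodyne (ρ : DensityOperator ℕ) (f : ℂ → ℂ) :
    ∫ z, f z ∂(heterodyne ρ) = ∫ z, f z *
      ((1 / Real.pi : ℝ) * inner ℂ (coherent z) (ρ.op (coherent z))) := by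
  rw [heterodyne, integral_withDensity_eq_integral_toReal_smul
    (measurable_husimiQ ρ).ennreal_ofReal (.of_forall fun _ => ENNReal.ofReal_lt_top)]
  refine integral_congr_ae (.of_forall fun z => ?_)
  simp only
  rw [ENNReal.toReal_ofReal (husimiQ_nonneg ρ z), ← ofReal_husimiQ, Complex.real_smul, mul_comm]

lemma DensityOperator.hasSum_elem_re (ρ : DensityOperator ℕ) :
    HasSum (fun n => (ρ.elem n n).re) 1 := by
  exact Complex.hasSum_re ρ.trace_eq_one

lemma DensityOperator.elem_re_nonneg (ρ : DensityOperator ℕ) (n : ℕ) : 0 ≤ (ρ.elem n n).re :=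
  (ρ.re_inner_nonneg _)

/-- The case `k = l = 0` of the expectation formula: `fEst 0 0` is a pure Gaussian. -/
lemma integral_exp_mul_husimiQ (ρ : DensityOperator ℕ) {η : ℝ} (hη : 0 < η) (hη1 : η < 1) :
    Integrable (fun z => Real.exp ((1 - 1 / η) * ‖z‖ ^ 2) * husimiQ ρ z) ∧
    ∫ z, Real.exp ((1 - 1 / η) * ‖z‖ ^ 2) * husimiQ ρ z =
      ∑' j : ℕ, (ρ.elem j j).re * η ^ (j + 1) := by
  obtain ⟨h1, h2⟩ := hasSum_integral_fEst ρ 0 0 hη hη1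
  have e : ∀ z : ℂ, fEst 0 0 η z * ((1 / Real.pi : ℝ) *
      inner ℂ (coherent z) (ρ.op (coherent z))) =
      ((1 / η * (Real.exp ((1 - 1 / η) * ‖z‖ ^ 2) * husimiQ ρ z) : ℝ) : ℂ) := by
    intro z
    rw [← ofReal_husimiQ, fEst]
    simp [laguerre2D]
    ring
  simp only [e] at h1 h2
  have h3 := h1.re
  simp only [RCLike.re_to_complex, Complex.ofReal_re] at h3
  rw [integrable_const_mul_iff (by simp [hη.ne'])] at h3
  refine ⟨h3, ?_⟩
  rw [integral_complex_ofReal, integral_const_mul] at h2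
  have h4 := (Complex.hasSum_re h2).mul_left η
  rw [Complex.ofReal_re, ← mul_assoc, mul_one_div_cancel hη.ne', one_mul] at h4
  rw [← h4.tsum_eq]
  refine tsum_congr fun j => ?_
  rw [Complex.re_mul_ofReal]
  simp
  ring

/-- Abel summation. The Gaussian-damped mass equals `∑ ρ_jj u ^ (j + 1)` for `u < 1`. As `u`
increases to `1`, monotone convergence gives the total mass on one side and dominated convergence
gives the trace on the other. -/
instance isProbabilityMeasure_heterodyne (ρ : DensityOperator ℕ) :
    IsProbabilityMeasure (heterodyne ρ) := by
  constructor
  rw [heterodyne, withDensity_apply _ MeasurableSet.univ, Measure.restrict_univ]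
  -- The shift by `2` keeps `u 0 = 1 / 2` positive.
  let u : ℕ → ℝ := fun n => 1 - 1 / ((n : ℝ) + 2)
  have hu0 : ∀ n, 0 < u n := fun n => by
    have : 1 / ((n : ℝ) + 2) < 1 := by
      rw [div_lt_one (by positivity)]
      have : (0 : ℝ) ≤ n := by positivity
      linarith
    simp only [u]
    linarith
  have hu1 : ∀ n, u n < 1 := fun n => by
    have : 0 < 1 / ((n : ℝ) + 2) := by positivity
    simp only [u]
    linarith
  have hmono : Monotone u := fun m n h => by
    have : (m : ℝ) ≤ n := by exact_mod_cast h
    have := one_div_le_one_div_of_le (by positivity : (0 : ℝ) < (m : ℝ) + 2)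
      (by linarith : (m : ℝ) + 2 ≤ (n : ℝ) + 2)
    simp only [u]
    linarith
  have hlim : Filter.Tendsto u Filter.atTop (nhds 1) := by
    have h : Filter.Tendsto (fun n : ℕ => 1 / ((n : ℝ) + 2)) Filter.atTop (nhds 0) := by
      have := (tendsto_const_div_atTop_nhds_zero_nat (1 : ℝ)).comp (Filter.tendsto_add_atTop_nat 2)
      refine this.congr fun n => ?_
      simp
    simpa [u] using h.const_sub 1
  have hQ := measurable_husimiQ ρ
  have t1 : Filter.Tendsto (fun n => ∫⁻ z, ENNReal.ofReal
      (Real.exp ((1 - 1 / u n) * ‖z‖ ^ 2) * husimiQ ρ z)) Filter.atTop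
      (nhds (∫⁻ z, ENNReal.ofReal (husimiQ ρ z))) := by
    refine lintegral_tendsto_of_tendsto_of_monotone (fun n => ?_) (.of_forall fun z m n h => ?_)
      (.of_forall fun z => ?_)
    · exact (((Continuous.measurable (by fun_prop)).mul hQ).ennreal_ofReal).aemeasurable
    · refine ENNReal.ofReal_le_ofReal (mul_le_mul_of_nonneg_right (Real.exp_le_exp.2
        (mul_le_mul_of_nonneg_right ?_ (sq_nonneg _))) (husimiQ_nonneg ρ z))
      have := one_div_le_one_div_of_le (hu0 m) (hmono h)
      linarith
    · refine ENNReal.tendsto_ofReal ?_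
      have h1 : Filter.Tendsto (fun n => Real.exp ((1 - 1 / u n) * ‖z‖ ^ 2)) Filter.atTop
          (nhds (Real.exp ((1 - 1 / 1) * ‖z‖ ^ 2))) :=
        (Real.continuous_exp.tendsto _).comp
          (((tendsto_const_nhds.div hlim one_ne_zero).const_sub 1).mul_const _)
      simpa using h1.mul_const (husimiQ ρ z)
  have t2 : Filter.Tendsto (fun n => ∫⁻ z, ENNReal.ofReal
      (Real.exp ((1 - 1 / u n) * ‖z‖ ^ 2) * husimiQ ρ z)) Filter.atTop (nhds 1) := by
    have e : ∀ n, ∫⁻ z, ENNReal.ofReal (Real.exp ((1 - 1 / u n) * ‖z‖ ^ 2) * husimiQ ρ z) =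
        ENNReal.ofReal (∑' j : ℕ, (ρ.elem j j).re * u n ^ (j + 1)) := by
      intro n
      obtain ⟨h1, h2⟩ := integral_exp_mul_husimiQ ρ (hu0 n) (hu1 n)
      rw [← h2, ofReal_integral_eq_lintegral_ofReal h1
        (.of_forall fun z => mul_nonneg (Real.exp_pos _).le (husimiQ_nonneg ρ z))]
    simp only [e]
    rw [← ENNReal.ofReal_one]
    refine ENNReal.tendsto_ofReal ?_
    rw [← ρ.hasSum_elem_re.tsum_eq]
    refine tendsto_tsum_of_dominated_convergence (bound := fun j => (ρ.elem j j).re)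
      ρ.hasSum_elem_re.summable (fun j => ?_) (.of_forall fun n j => ?_)
    · simpa using (hlim.pow (j + 1)).const_mul (ρ.elem j j).re
    · rw [Real.norm_of_nonneg (mul_nonneg (ρ.elem_re_nonneg j) (pow_nonneg (hu0 n).le _))]
      exact mul_le_of_le_one_right (ρ.elem_re_nonneg j) (pow_le_one₀ (hu0 n).le (hu1 n).le)
  exact tendsto_nhds_unique t1 t2

/-! ### Expectation and bias of the core-state estimator -/

/-- The weight of the `q`-th diagonal shift in the expectation of `g^{(p)}`. -/
def shiftWeight (p q : ℕ) : ℤ := ∑ j ∈ range p, (-1) ^ j * (q.choose j : ℤ)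

lemma shiftWeight_zero {p : ℕ} (hp : 0 < p) : shiftWeight p 0 = 1 := by
  obtain ⟨p, rfl⟩ := Nat.exists_eq_add_of_lt hp
  simp [shiftWeight, sum_range_succ']

/-- A partial alternating row sum of Pascal's triangle is, up to sign, one entry of the previous
row. In particular the weight vanishes for shifts between `1` and `p - 1`. -/
lemma abs_shiftWeight_succ {p : ℕ} (hp : 0 < p) (q : ℕ) :
    |(shiftWeight p (q + 1) : ℝ)| = (q.choose (p - 1) : ℝ) := by
  obtain ⟨p, rfl⟩ := Nat.exists_eq_add_of_lt hp
  rw [shiftWeight, zero_add, Int.alternating_sum_range_choose_eq_choose]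
  push_cast
  rw [abs_mul, abs_pow, abs_neg, abs_one, one_pow, one_mul, Nat.abs_cast]

/-- Index every expansion by the total shift `q`. Since `C(a+j,a) C(a+q,a+j) = C(a+q,a) C(q,j)` for
both `a = k` and `a = l`, the dependence on `j` under the root is the square of `C(q,j)`, and the
sum over `j` is `shiftWeight p q`. -/
lemma hasSum_integral_gEst (ρ : DensityOperator ℕ) (p k l : ℕ) {η : ℝ} (hη : 0 < η)
    (hη1 : η < 1) :
    Integrable (fun z : ℂ => gEst p k l η z *
      ((1 / Real.pi : ℝ) * inner ℂ (coherent z) (ρ.op (coherent z)))) ∧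
    HasSum (fun q : ℕ => ρ.elem (k + q) (l + q) * ((η ^ q * (shiftWeight p q : ℝ) *
        Real.sqrt (((k + q).choose k : ℝ) * ((l + q).choose l : ℝ)) : ℝ) : ℂ))
      (∫ z : ℂ, gEst p k l η z *
        ((1 / Real.pi : ℝ) * inner ℂ (coherent z) (ρ.op (coherent z)))) := by
  have hf := fun j => hasSum_integral_fEst ρ (k + j) (l + j) hη hη1
  simp only [gEst, sum_mul, mul_assoc]
  have hi : ∀ j ∈ range p, Integrable fun z : ℂ => (((-1) ^ j * (η ^ j *
      Real.sqrt (((k + j).choose k : ℝ) * ((l + j).choose l : ℝ))) : ℝ) : ℂ) *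
      (fEst (k + j) (l + j) η z *
        ((1 / Real.pi : ℝ) * inner ℂ (coherent z) (ρ.op (coherent z)))) :=
    fun j _ => (hf j).1.const_mul _
  refine ⟨integrable_finsetSum _ hi, ?_⟩
  rw [integral_finsetSum _ hi]
  simp only [integral_const_mul]
  have hshift : ∀ j, HasSum (fun q : ℕ => ρ.elem (k + q) (l + q) *
      ((if j ≤ q then η ^ (q - j) * Real.sqrt (((k + q).choose (k + j) : ℝ) *
        ((l + q).choose (l + j) : ℝ)) else 0 : ℝ) : ℂ))
      (∫ z : ℂ, fEst (k + j) (l + j) η z *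
        ((1 / Real.pi : ℝ) * inner ℂ (coherent z) (ρ.op (coherent z)))) := by
    intro j
    have hinj : Function.Injective fun i : ℕ => j + i := fun a b h => by simpa using h
    rw [← hinj.hasSum_iff]
    · refine (hasSum_iff_of_forall_eq fun i => ?_).1 (hf j).2
      simp only [Function.comp]
      rw [if_pos (by omega), Nat.add_sub_cancel_left, ← add_assoc, ← add_assoc]
    · intro q hq
      rw [if_neg]
      · simp
      · intro h
        exact hq ⟨q - j, by simp; omega⟩
  refine (hasSum_iff_of_forall_eq fun q => ?_).1
    (hasSum_sum (s := range p) fun j _ => (hshift j).mul_left (((-1) ^ j * (η ^ j *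
      Real.sqrt (((k + j).choose k : ℝ) * ((l + j).choose l : ℝ))) : ℝ) : ℂ))
  rw [shiftWeight, Int.cast_sum, sum_mul, mul_sum, Complex.ofReal_sum, mul_sum]
  refine sum_congr rfl fun j _ => ?_
  rw [mul_left_comm, ← Complex.ofReal_mul]
  congr 2
  split_ifs with h
  · have e : ∀ a : ℕ, ((a + j).choose a : ℝ) * ((a + q).choose (a + j) : ℝ) =
        ((a + q).choose a : ℝ) * (q.choose j : ℝ) := by
      intro a
      have := Nat.choose_mul (n := a + q) (k := a + j) (s := a) (by omega)
      rw [Nat.add_sub_cancel_left, Nat.add_sub_cancel_left] at this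
      rw [mul_comm]
      exact_mod_cast this
    have e2 : Real.sqrt (((k + j).choose k : ℝ) * ((l + j).choose l : ℝ)) *
        Real.sqrt (((k + q).choose (k + j) : ℝ) * ((l + q).choose (l + j) : ℝ)) =
        (q.choose j : ℝ) * Real.sqrt (((k + q).choose k : ℝ) * ((l + q).choose l : ℝ)) := by
      have hq : (q.choose j : ℝ) = Real.sqrt ((q.choose j : ℝ) ^ 2) :=
        (Real.sqrt_sq (by positivity)).symm
      rw [hq, ← Real.sqrt_mul (by positivity), ← Real.sqrt_mul (by positivity)]
      congr 1
      rw [mul_mul_mul_comm, e, e]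
      ring
    have e3 : η ^ q = η ^ j * η ^ (q - j) := by
      rw [← pow_add]
      congr 1
      omega
    rw [e3]
    push_cast
    linear_combination ((-1) ^ j * η ^ j * η ^ (q - j)) * e2
  · simp [Nat.choose_eq_zero_of_lt (not_le.1 h)]

/-- The vector `∑ₖ c_k √C(k+q,k) |k+q⟩`. -/
noncomputable def shiftVec {c : ℕ} (C : Fin c → ℂ) (q : ℕ) : FockSpace ℕ :=
  ∑ k : Fin c, (C k * (Real.sqrt (((k : ℕ) + q).choose k : ℝ) : ℂ)) • ket ((k : ℕ) + q)

lemma shiftVec_zero {c : ℕ} (C : Fin c → ℂ) : shiftVec C 0 = coreVec C := by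
  simp [shiftVec, coreVec]

lemma inner_shiftVec {c : ℕ} (C : Fin c → ℂ) (q : ℕ) (ρ : DensityOperator ℕ) :
    inner ℂ (shiftVec C q) (ρ.op (shiftVec C q)) = ∑ k : Fin c, ∑ l : Fin c,
      conj (C k) * C l * (ρ.elem (k + q) (l + q) *
        (Real.sqrt ((((k : ℕ) + q).choose k : ℝ) * (((l : ℕ) + q).choose l : ℝ)) : ℂ)) := by
  rw [shiftVec, map_sum, sum_inner]
  refine sum_congr rfl fun k _ => ?_
  rw [inner_sum]
  refine sum_congr rfl fun l _ => ?_
  rw [map_smul, inner_smul_left, inner_smul_right, Real.sqrt_mul (by positivity), map_mul,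
    Complex.conj_ofReal, DensityOperator.elem]
  push_cast
  ring

/-- Each shift contributes a quadratic form of `ρ`, so positivity can be used on it; the form at `q
= 0` is the fidelity. -/
lemma hasSum_integral_gCore {c : ℕ} (C : Fin c → ℂ) (ρ : DensityOperator ℕ) (p : ℕ) {η : ℝ}
    (hη : 0 < η) (hη1 : η < 1) :
    HasSum (fun q : ℕ => ((η ^ q * (shiftWeight p q : ℝ) : ℝ) : ℂ) *
        inner ℂ (shiftVec C q) (ρ.op (shiftVec C q)))
      (∫ z, gCore C p η z ∂(heterodyne ρ)) := by
  have hg := fun k l => hasSum_integral_gEst ρ p k l hη hη1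
  rw [integral_heterodyne]
  simp only [gCore, sum_mul, mul_assoc]
  have hi : ∀ k l : Fin c, Integrable fun z : ℂ => conj (C k) * (C l * (gEst p k l η z *
      ((1 / Real.pi : ℝ) * inner ℂ (coherent z) (ρ.op (coherent z))))) :=
    fun k l => ((hg k l).1.const_mul _).const_mul _
  rw [integral_finsetSum _ fun k _ => integrable_finsetSum _ fun l _ => hi k l]
  have e : ∀ k : Fin c, ∫ z : ℂ, ∑ l : Fin c, conj (C k) * (C l * (gEst p k l η z *
      ((1 / Real.pi : ℝ) * inner ℂ (coherent z) (ρ.op (coherent z))))) =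
      ∑ l : Fin c, conj (C k) * (C l * ∫ z : ℂ, gEst p k l η z *
        ((1 / Real.pi : ℝ) * inner ℂ (coherent z) (ρ.op (coherent z)))) := by
    intro k
    rw [integral_finsetSum _ fun l _ => hi k l]
    simp only [integral_const_mul]
  simp only [e]
  refine (hasSum_iff_of_forall_eq fun q => ?_).1 (hasSum_sum (s := univ) fun k _ =>
    hasSum_sum (s := univ) fun l _ => ((hg k l).2.mul_left (C l)).mul_left (conj (C k)))
  rw [inner_shiftVec, mul_sum]
  refine sum_congr rfl fun k _ => ?_
  rw [mul_sum]
  refine sum_congr rfl fun l _ => ?_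
  push_cast
  ring

/-- The left side vanishes for `q + 1 < p`, equals the right side at `q + 1 = p`, and is
non-increasing afterwards. The condition on `η` is exactly that the first ratio, at the largest
index `k = c - 1`, is at most one. -/
lemma pow_mul_choose_mul_choose_le {c p : ℕ} (hp : 0 < p) {η : ℝ} (hη : 0 < η)
    (hη2 : η ≤ ((p : ℝ) + 1) / ((p : ℝ) * ((p : ℝ) + c))) {k : ℕ} (hk : k < c) (q : ℕ) :
    η ^ (q + 1) * ((q.choose (p - 1) : ℝ) * ((k + (q + 1)).choose k : ℝ)) ≤
      η ^ p * ((k + p).choose k : ℝ) := by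
  obtain ⟨P, rfl⟩ := Nat.exists_eq_add_of_lt hp
  rw [zero_add] at *
  rw [Nat.add_sub_cancel]
  rcases lt_or_ge q P with hq | hq
  · rw [Nat.choose_eq_zero_of_lt hq]
    simp only [Nat.cast_zero, zero_mul, mul_zero]
    positivity
  obtain ⟨i, rfl⟩ := Nat.exists_eq_add_of_le hq
  clear hq
  induction i with
  | zero => simp
  | succ i ih =>
    refine le_trans ?_ ih
    have h1 : ((P + (i + 1)).choose P : ℝ) * (i + 1) = (P + i + 1) * ((P + i).choose P : ℝ) := by
      have := Nat.choose_mul_succ_eq (P + i) P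
      rw [show P + i + 1 - P = i + 1 by omega] at this
      rw [mul_comm ((P : ℝ) + i + 1)]
      exact_mod_cast this.symm
    have h2 : ((k + (P + (i + 1) + 1)).choose k : ℝ) * (P + i + 2) =
        (k + P + i + 2) * ((k + (P + i + 1)).choose k : ℝ) := by
      have := Nat.choose_mul_succ_eq (k + (P + i + 1)) k
      rw [show k + (P + i + 1) + 1 - k = P + i + 2 by omega] at this
      have h' : ((k + (P + i + 1)).choose k : ℝ) * (k + (P + i + 1) + 1) =
        ((k + (P + i + 1) + 1).choose k : ℝ) * (P + i + 2) := by exact_mod_cast this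
      rw [show k + (P + (i + 1) + 1) = k + (P + i + 1) + 1 by ring, ← h']
      ring
    have hP : (0 : ℝ) ≤ P := by positivity
    have hi0 : (0 : ℝ) ≤ i := by positivity
    have hk0 : (0 : ℝ) ≤ k := by positivity
    have hkc : (k : ℝ) + 1 ≤ c := by exact_mod_cast hk
    have h3 : η * ((P + 1) * (P + k + 2)) ≤ (P : ℝ) + 2 := by
      rw [le_div_iff₀ (by positivity)] at hη2
      push_cast at hη2
      refine le_trans (mul_le_mul_of_nonneg_left (mul_le_mul_of_nonneg_left ?_ ?_) hη.le)
        (hη2.trans (le_of_eq ?_)) <;> linarith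
    -- Later ratios are no larger than the first: `h5` and `h6` compare the factors with those at `i
    -- = 0`.
    have h4 : η * ((P + i + 1) * (k + P + i + 2)) ≤ ((i : ℝ) + 1) * (P + i + 2) := by
      have h5 : ((P : ℝ) + i + 1) ≤ (P + 1) * (i + 1) := by nlinarith
      have h6 : ((k : ℝ) + P + i + 2) * (P + 2) ≤ (P + k + 2) * (P + i + 2) := by nlinarith
      have h7 : ((P : ℝ) + i + 1) * ((k + P + i + 2) * (P + 2)) ≤
          ((P + 1) * (i + 1)) * ((P + k + 2) * (P + i + 2)) := by gcongr
      have h8 := mul_le_mul_of_nonneg_left h7 hη.le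
      have h9 := mul_le_mul_of_nonneg_right h3 (show 0 ≤ ((i : ℝ) + 1) * (P + i + 2) by positivity)
      have : 0 < (P : ℝ) + 2 := by positivity
      refine le_of_mul_le_mul_right ?_ this
      linarith
    have h10 : (0 : ℝ) < (i + 1) * (P + i + 2) := by positivity
    refine le_of_mul_le_mul_right ?_ h10
    calc _ = η ^ (P + i + 1) * (η * (((P + (i + 1)).choose P : ℝ) * (i + 1) *
          (((k + (P + (i + 1) + 1)).choose k : ℝ) * (P + i + 2)))) := by ring
      _ = η ^ (P + i + 1) * (((P + i).choose P : ℝ) * ((k + (P + i + 1)).choose k : ℝ)) *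
          (η * ((P + i + 1) * (k + P + i + 2))) := by
          rw [h1, h2]
          ring
      _ ≤ _ := by gcongr

/-- The bias of the estimator. -/
lemma norm_integral_gCore_sub_le {c : ℕ} (C : Fin c → ℂ) (ρ : DensityOperator ℕ) {p : ℕ}
    (hp : 0 < p) {η : ℝ} (hη : 0 < η) (hη1 : η < 1)
    (hη2 : η ≤ ((p : ℝ) + 1) / ((p : ℝ) * ((p : ℝ) + c))) :
    ‖(∫ z, gCore C p η z ∂(heterodyne ρ)) - inner ℂ (coreVec C) (ρ.op (coreVec C))‖ ≤
      η ^ p * constA C p := by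
  have h := (hasSum_nat_add_iff' 1).2 (hasSum_integral_gCore C ρ p hη hη1)
  rw [sum_range_one, pow_zero, shiftWeight_zero hp, shiftVec_zero] at h
  simp only [Int.cast_one, mul_one, Complex.ofReal_one, one_mul] at h
  obtain ⟨S, hS⟩ := ρ.exists_inner_eq_norm_sq
  have hr : ∀ n, ‖S (ket n)‖ ^ 2 = (ρ.elem n n).re := by
    intro n
    rw [DensityOperator.elem, hS, Complex.ofReal_re]
  let a : Fin c → ℝ := fun k => ‖C k‖ * Real.sqrt (((k : ℕ) + p).choose k : ℝ)
  have ha : ∀ k, 0 ≤ a k := fun k => by positivity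
  have hA : constA C p = (∑ k, a k) * ∑ k, a k := by rw [constA, sq]
  -- Majorant from the weighted Cauchy–Schwarz inequality `(∑ a x)² ≤ (∑ a) (∑ a x²)`, where `x²` is
  -- a diagonal element of `ρ`. Summing over `q` at fixed `k` gives at most the trace, hence `(∑ a)²
  -- = constA C p`.
  let b : ℕ → ℝ := fun q => η ^ p * ((∑ k, a k) * ∑ k : Fin c, a k * (ρ.elem (k + (q + 1))
    (k + (q + 1))).re)
  have hk : ∀ k : ℕ, Summable (fun q => (ρ.elem (k + (q + 1)) (k + (q + 1))).re) ∧
      ∑' q, (ρ.elem (k + (q + 1)) (k + (q + 1))).re ≤ 1 := by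
    intro k
    have hinj : Function.Injective fun q : ℕ => k + (q + 1) := fun x y h => by simpa using h
    refine ⟨ρ.hasSum_elem_re.summable.comp_injective hinj, ?_⟩
    rw [← ρ.hasSum_elem_re.tsum_eq]
    exact tsum_comp_le_tsum_of_inj ρ.hasSum_elem_re.summable ρ.elem_re_nonneg hinj
  have hb : HasSum b (η ^ p * ((∑ k, a k) * ∑ k : Fin c, a k *
      ∑' q, (ρ.elem (k + (q + 1)) (k + (q + 1))).re)) :=
    ((hasSum_sum fun (k : Fin c) _ => (hk k).1.hasSum.mul_left (a k)).mul_left _).mul_left _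
  refine (h.norm_le_of_bounded hb fun q => ?_).trans ?_
  · have h1 : ‖inner ℂ (shiftVec C (q + 1)) (ρ.op (shiftVec C (q + 1)))‖ ≤
        (∑ k : Fin c, ‖C k‖ * Real.sqrt (((k : ℕ) + (q + 1)).choose k : ℝ) *
          ‖S (ket ((k : ℕ) + (q + 1)))‖) ^ 2 := by
      rw [hS, Complex.norm_real, norm_pow, norm_norm]
      refine pow_le_pow_left₀ (norm_nonneg _) ?_ 2
      rw [shiftVec, map_sum]
      refine norm_sum_le_of_le _ fun k _ => ?_
      rw [map_smul, norm_smul, norm_mul, Complex.norm_real, Real.norm_of_nonneg (Real.sqrt_nonneg _)]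
    rw [norm_mul, Complex.norm_real, norm_mul, Real.norm_of_nonneg (by positivity), Real.norm_eq_abs,
      abs_shiftWeight_succ hp]
    -- The weight is moved inside the square, so that it meets the binomial of each `k` under a
    -- common root and can be bounded term by term.
    set W : ℝ := η ^ (q + 1) * (q.choose (p - 1) : ℝ) with hW
    have hW0 : 0 ≤ W := by positivity
    calc _ ≤ W * (∑ k : Fin c, ‖C k‖ * Real.sqrt (((k : ℕ) + (q + 1)).choose k : ℝ) *
          ‖S (ket ((k : ℕ) + (q + 1)))‖) ^ 2 := by gcongr
      _ = (∑ k : Fin c, ‖C k‖ * Real.sqrt (W * (((k : ℕ) + (q + 1)).choose k : ℝ)) *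
          ‖S (ket ((k : ℕ) + (q + 1)))‖) ^ 2 := by
          rw [← Real.sq_sqrt hW0, ← mul_pow, mul_sum, Real.sq_sqrt hW0]
          congr 1
          refine sum_congr rfl fun k _ => ?_
          rw [Real.sqrt_mul hW0]
          ring
      _ ≤ (∑ k : Fin c, ‖C k‖ * Real.sqrt (η ^ p * (((k : ℕ) + p).choose k : ℝ)) *
          ‖S (ket ((k : ℕ) + (q + 1)))‖) ^ 2 := by
          refine pow_le_pow_left₀ (by positivity) (sum_le_sum fun k _ => mul_le_mul_of_nonneg_right
            (mul_le_mul_of_nonneg_left (Real.sqrt_le_sqrt ?_) (norm_nonneg _)) (norm_nonneg _)) 2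
          rw [hW, mul_assoc]
          exact pow_mul_choose_mul_choose_le hp hη hη2 k.2 q
      _ = η ^ p * (∑ k : Fin c, a k * ‖S (ket ((k : ℕ) + (q + 1)))‖) ^ 2 := by
          have hη0 : 0 ≤ η ^ p := by positivity
          conv_rhs => rw [← Real.sq_sqrt hη0, ← mul_pow, mul_sum]
          congr 1
          refine sum_congr rfl fun k _ => ?_
          rw [Real.sqrt_mul hη0]
          simp only [a]
          ring
      _ ≤ b q := by
          refine mul_le_mul_of_nonneg_left ?_ (by positivity)
          refine sum_sq_le_sum_mul_sum_of_sq_le_mul _ (fun k _ => ha k)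
            (fun k _ => mul_nonneg (ha k) (ρ.elem_re_nonneg _)) fun k _ => le_of_eq ?_
          rw [mul_pow, hr]
          ring
  · rw [hA]
    have : ∑ k : Fin c, a k * ∑' q, (ρ.elem (k + (q + 1)) (k + (q + 1))).re ≤ ∑ k, a k :=
      sum_le_sum fun k _ => mul_le_of_le_one_right (ha k) (hk k).2
    have h0 : 0 ≤ ∑ k, a k := sum_nonneg fun k _ => ha k
    gcongr

/-! ### Hoeffding's inequality -/

/-- **Hoeffding's inequality** for the empirical mean of i.i.d. samples. -/
lemma measureReal_pi_abs_mean_sub_ge_le {X : Type*} [MeasurableSpace X] (μ : Measure X)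
    [IsProbabilityMeasure μ] {g : X → ℝ} (hg : Measurable g) {D : ℝ} (hD : 0 < D)
    (hb : ∀ x, |g x| ≤ D) {N : ℕ} (hN : 0 < N) {t : ℝ} (ht : 0 < t) :
    (Measure.pi fun _ : Fin N => μ).real {α | t ≤ |(∑ i, g (α i)) / N - ∫ x, g x ∂μ|} ≤
      2 * Real.exp (-(N * t ^ 2 / (2 * D ^ 2))) := by
  set P := Measure.pi fun _ : Fin N => μ
  have hN' : (0 : ℝ) < N := by exact_mod_cast hN
  -- The variance proxy is the square of half the length of `[-D, D]`.
  set c : NNReal := (‖D - -D‖₊ / 2) ^ 2 with hc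
  have hcD : (c : ℝ) = D ^ 2 := by
    rw [hc]
    push_cast
    rw [Real.norm_of_nonneg (by linarith)]
    ring
  have h0 : ProbabilityTheory.HasSubgaussianMGF (fun x => g x - ∫ x, g x ∂μ) c μ :=
    ProbabilityTheory.hasSubgaussianMGF_of_mem_Icc hg.aemeasurable
      (.of_forall fun x => abs_le.1 (hb x))
  have hX : ∀ f : X → ℝ, Measurable f → ProbabilityTheory.HasSubgaussianMGF f c μ →
      P.real {α | N * t ≤ ∑ i, f (α i)} ≤ Real.exp (-(N * t ^ 2 / (2 * D ^ 2))) := by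
    intro f hfm hf
    have hind : ProbabilityTheory.iIndepFun (fun (i : Fin N) (α : Fin N → X) => f (α i)) P :=
      ProbabilityTheory.iIndepFun_pi (X := fun _ => f) fun _ => hfm.aemeasurable
    have hsub : ∀ i ∈ (univ : Finset (Fin N)),
        ProbabilityTheory.HasSubgaussianMGF (fun α : Fin N → X => f (α i)) c P := fun i _ => by
      refine ProbabilityTheory.HasSubgaussianMGF.of_map (X := f) (Y := fun α : Fin N → X => α i)
        (measurable_pi_apply i).aemeasurable ?_
      rwa [(measurePreserving_eval (fun _ : Fin N => μ) i).map_eq]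
    refine (ProbabilityTheory.HasSubgaussianMGF.measure_sum_ge_le_of_iIndepFun hind hsub
      (ε := N * t) (by positivity)).trans (le_of_eq ?_)
    congr 1
    simp only [sum_const, card_univ, Fintype.card_fin, nsmul_eq_mul]
    push_cast
    rw [hcD]
    field_simp
  have h1 := hX _ (hg.sub_const _) h0
  have h2 := hX _ (hg.sub_const _).neg h0.neg
  have hsub : {α : Fin N → X | t ≤ |(∑ i, g (α i)) / N - ∫ x, g x ∂μ|} ⊆
      {α | N * t ≤ ∑ i, (g (α i) - ∫ x, g x ∂μ)} ∪
        {α | N * t ≤ ∑ i, (-(fun x => g x - ∫ x, g x ∂μ)) (α i)} := by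
    intro α hα
    have e : ∑ i, (g (α i) - ∫ x, g x ∂μ) = N * ((∑ i, g (α i)) / N - ∫ x, g x ∂μ) := by
      rw [sum_sub_distrib]
      simp
      field_simp
    rcases le_abs.1 (show t ≤ _ from hα) with h | h
    · left
      simp only [Set.mem_ofPred_eq, e]
      gcongr
    · right
      simp only [Set.mem_ofPred_eq, Pi.neg_apply, sum_neg_distrib, e, ← mul_neg]
      gcongr
  calc _ ≤ _ := measureReal_mono hsub
    _ ≤ _ := measureReal_union_le _ _
    _ ≤ _ := by linarith

/-! ### Fidelities -/

lemma inner_coreVec {c : ℕ} (C : Fin c → ℂ) (ρ : DensityOperator ℕ) :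
    inner ℂ (coreVec C) (ρ.op (coreVec C)) =
      ∑ k : Fin c, ∑ l : Fin c, conj (C k) * C l * ρ.elem k l := by
  rw [← shiftVec_zero, inner_shiftVec]
  simp

lemma ofReal_fidelity (ψ : FockSpace ℕ) (ρ : DensityOperator ℕ) :
    (fidelity ψ ρ : ℂ) = inner ℂ ψ (ρ.op ψ) :=
  ρ.ofReal_re_inner ψ

lemma coreVec_apply {c : ℕ} (C : Fin c → ℂ) (m : ℕ) :
    coreVec C m = ∑ n : Fin c, C n * if m = n then 1 else 0 := by
  rw [coreVec, lp.coeFn_sum, Finset.sum_apply]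
  refine sum_congr rfl fun n _ => ?_
  rw [lp.coeFn_smul, Pi.smul_apply, ket_apply, smul_eq_mul]

lemma vecPower_coreVec {c : ℕ} (C : Fin c → ℂ) (M : ℕ) :
    vecPower (coreVec C) M =
      ∑ f : Fin M → Fin c, (∏ i, C (f i)) • ket (fun i => (f i : ℕ)) := by
  classical
  ext k
  rw [vecPower, prodVec_apply, lp.coeFn_sum, Finset.sum_apply]
  simp only [coreVec_apply]
  rw [prod_univ_sum, Fintype.piFinset_univ]
  refine sum_congr rfl fun f _ => ?_
  rw [lp.coeFn_smul, Pi.smul_apply, ket_apply, smul_eq_mul, prod_mul_distrib]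
  congr 1
  by_cases h : k = fun i => (f i : ℕ)
  · subst h
    simp
  · rw [if_neg h]
    obtain ⟨i, hi⟩ := Function.ne_iff.1 h
    exact prod_eq_zero (mem_univ i) (if_neg hi)

/-- The tensor power is known through its matrix elements, which suffices because a core state is a
finite combination of kets: expanding both sides over multi-indices turns the power of a double sum
into a sum of products. -/
lemma fidelity_tensorPower {c : ℕ} (C : Fin c → ℂ) (ρ : DensityOperator ℕ) (M : ℕ) :
    fidelity (vecPower (coreVec C) M) (ρ.tensorPower M) = fidelity (coreVec C) ρ ^ M := by
  have h : inner ℂ (vecPower (coreVec C) M) ((ρ.tensorPower M).op (vecPower (coreVec C) M)) =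
      inner ℂ (coreVec C) (ρ.op (coreVec C)) ^ M := by
    have e : inner ℂ (coreVec C) (ρ.op (coreVec C)) ^ M =
        ∏ _i : Fin M, inner ℂ (coreVec C) (ρ.op (coreVec C)) := by simp
    rw [e, inner_coreVec]
    simp only [prod_univ_sum, Fintype.piFinset_univ]
    rw [vecPower_coreVec, map_sum, sum_inner]
    refine sum_congr rfl fun f _ => ?_
    rw [inner_sum]
    refine sum_congr rfl fun g _ => ?_
    rw [map_smul, inner_smul_left, inner_smul_right, ρ.tensorPower_spec, prod_mul_distrib,
      prod_mul_distrib, map_prod, mul_assoc]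
    rfl
  rw [fidelity, h, ← ofReal_fidelity, ← Complex.ofReal_pow, Complex.ofReal_re]

lemma fidelity_nonneg (ψ : FockSpace ℕ) (ρ : DensityOperator ℕ) : 0 ≤ fidelity ψ ρ :=
  ρ.re_inner_nonneg ψ

/-- Cauchy–Schwarz against the partial trace over the first `c` levels, which is at most one. -/
lemma fidelity_coreVec_le_one {c : ℕ} (C : Fin c → ℂ) (hC : ∑ n, ‖C n‖ ^ 2 = 1)
    (ρ : DensityOperator ℕ) : fidelity (coreVec C) ρ ≤ 1 := by
  obtain ⟨S, hS⟩ := ρ.exists_inner_eq_norm_sq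
  have hr : ∀ n, ‖S (ket n)‖ ^ 2 = (ρ.elem n n).re := by
    intro n
    rw [DensityOperator.elem, hS, Complex.ofReal_re]
  rw [fidelity, hS, Complex.ofReal_re]
  calc ‖S (coreVec C)‖ ^ 2 ≤ (∑ n : Fin c, ‖C n‖ * ‖S (ket (n : ℕ))‖) ^ 2 := by
        refine pow_le_pow_left₀ (norm_nonneg _) ?_ 2
        rw [coreVec, map_sum]
        refine norm_sum_le_of_le _ fun n _ => ?_
        rw [map_smul, norm_smul]
    _ ≤ (∑ n : Fin c, ‖C n‖ ^ 2) * ∑ n : Fin c, ‖S (ket (n : ℕ))‖ ^ 2 :=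
        sum_mul_sq_le_sq_mul_sq _ _ _
    _ ≤ 1 := by
        rw [hC, one_mul]
        simp only [hr]
        rw [Fin.sum_univ_eq_sum_range (fun n => (ρ.elem n n).re)]
        exact sum_le_hasSum _ (fun n _ => ρ.elem_re_nonneg n) ρ.hasSum_elem_re

/-! ### Constants -/

lemma one_le_constA {c : ℕ} (C : Fin c → ℂ) (hC : ∑ n, ‖C n‖ ^ 2 = 1) (p : ℕ) :
    1 ≤ constA C p := by
  have h : ∀ n : Fin c, ‖C n‖ ≤ ‖C n‖ * Real.sqrt (((n : ℕ) + p).choose n : ℝ) := fun n => by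
    refine le_mul_of_one_le_right (norm_nonneg _) (Real.one_le_sqrt.2 ?_)
    exact_mod_cast Nat.choose_pos (by omega)
  calc 1 = ∑ n, ‖C n‖ ^ 2 := hC.symm
    _ ≤ (∑ n, ‖C n‖) ^ 2 := by
      rw [sq (∑ n, ‖C n‖), sum_mul]
      refine sum_le_sum fun n _ => ?_
      rw [sq]
      exact mul_le_mul_of_nonneg_left
        (single_le_sum (f := fun n => ‖C n‖) (fun n _ => norm_nonneg _) (mem_univ n)) (norm_nonneg _)
    _ ≤ constA C p := pow_le_pow_left₀ (sum_nonneg fun n _ => norm_nonneg _)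
      (sum_le_sum fun n _ => h n) 2

lemma constB_pos {c : ℕ} (C : Fin c → ℂ) (hC : ∑ n, ‖C n‖ ^ 2 = 1) (p : ℕ) {η : ℝ}
    (hη : 0 < η) : 0 < constB C p η := by
  have hnn : ∀ k l : Fin c, 0 ≤ ‖C k * C l‖ *
      η ^ ((c : ℝ) - 1 - (((k : ℕ) : ℝ) + ((l : ℕ) : ℝ)) / 2) *
      ((max (k : ℕ) l + p).choose (p - 1) : ℝ) *
      Real.sqrt (2 ^ (max (k : ℕ) l - min (k : ℕ) l) *
        ((max (k : ℕ) l).choose (min (k : ℕ) l) : ℝ)) := fun k l => by positivity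
  obtain ⟨k, hk⟩ : ∃ k, C k ≠ 0 := by
    by_contra! h
    simp [h] at hC
  refine sum_pos' (fun k _ => sum_nonneg fun l _ => hnn k l) ⟨k, mem_univ k, ?_⟩
  refine sum_pos' (fun l _ => hnn k l) ⟨k, mem_univ k, ?_⟩
  have h1 : 0 < ‖C k * C k‖ := norm_pos_iff.2 (mul_ne_zero hk hk)
  have h2 : (0 : ℝ) < ((max (k : ℕ) k + p).choose (p - 1) : ℝ) := by
    exact_mod_cast Nat.choose_pos (by omega)
  have h3 := one_le_sqrt_two_pow_mul_choose (max (k : ℕ) k) (min (k : ℕ) k) (by omega)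
  have h4 : 0 < η ^ ((c : ℝ) - 1 - (((k : ℕ) : ℝ) + ((k : ℕ) : ℝ)) / 2) := Real.rpow_pos_of_pos hη _
  positivity

/-- All exponents `c - 1 - (k + l) / 2` are nonnegative. This provides a bound independent of `η`
for the sample complexity. -/
lemma constB_le_constB_one {c : ℕ} (C : Fin c → ℂ) (p : ℕ) {η : ℝ} (hη : 0 < η) (hη1 : η ≤ 1) :
    constB C p η ≤ constB C p 1 := by
  unfold constB
  gcongr with k _ l _
  have hk : ((k : ℕ) : ℝ) + 1 ≤ c := by exact_mod_cast k.2
  have hl : ((l : ℕ) : ℝ) + 1 ≤ c := by exact_mod_cast l.2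
  linarith

/-! ### Concentration of the estimate -/

lemma measurable_gCore {c : ℕ} (C : Fin c → ℂ) (p : ℕ) (η : ℝ) : Measurable (gCore C p η) := by
  unfold gCore gEst fEst laguerre2D
  refine Continuous.measurable ?_
  fun_prop

/-- The first term of `etaMax` keeps the bias below `c * t / (c + p)`, leaving `p * t / (c + p)` for
Hoeffding. With `constB` held fixed, and `η ^ p` proportional to the bias share `λ`, the choice `λ =
c / (c + p)` maximises the rate `(1 - λ)² λ ^ (2c/p)`. -/
lemma one_sub_le_measureReal_abs_fidelity_sub_meanEst_le {c : ℕ} (hc : 0 < c) (C : Fin c → ℂ)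
    (hC : ∑ n, ‖C n‖ ^ 2 = 1) {p : ℕ} (hp : 0 < p) (ρ : DensityOperator ℕ) {N : ℕ} (hN : 0 < N)
    {t : ℝ} (ht : 0 < t) {η : ℝ} (hη : 0 < η) (hη1 : η < 1) (hηt : η ≤ etaMax C p t) :
    1 - 2 * Real.exp (-(N * ((p * t / (c + p)) ^ 2 * η ^ (2 * c) / (2 * constB C p η ^ 2)))) ≤
      (heterodyneSamples ρ N).real {α | |fidelity (coreVec C) ρ - meanEst C p η α| ≤ t} := by
  have hc' : (0 : ℝ) < c := by exact_mod_cast hc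
  have hp' : (0 : ℝ) < p := by exact_mod_cast hp
  have hA := one_le_constA C hC p
  have hB := constB_pos C hC p hη
  have hη2 := hηt.trans (min_le_right _ _)
  set E : ℝ := ∫ z, (gCore C p η z).re ∂(heterodyne ρ) with hE
  have hEc : ∫ z, gCore C p η z ∂(heterodyne ρ) = (E : ℂ) := by
    rw [hE, ← integral_complex_ofReal]
    refine integral_congr_ae (.of_forall fun z => ?_)
    exact Complex.ext (by simp) (by simp [gCore_im])
  have hbias : |E - fidelity (coreVec C) ρ| ≤ c * t / (c + p) := by
    have h := norm_integral_gCore_sub_le C ρ hp hη hη1 hη2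
    rw [hEc, ← ofReal_fidelity, ← Complex.ofReal_sub, Complex.norm_real, Real.norm_eq_abs] at h
    refine h.trans ?_
    have h1 : η ^ p ≤ c * t / ((c + p) * constA C p) := by
      calc η ^ p ≤ ((c * t / ((c + p) * constA C p)) ^ (1 / (p : ℝ))) ^ p :=
            pow_le_pow_left₀ hη.le (hηt.trans (min_le_left _ _)) p
        _ = _ := by
            rw [one_div, Real.rpow_inv_natCast_pow (by positivity) hp.ne']
    calc _ ≤ c * t / ((c + p) * constA C p) * constA C p := by gcongr
      _ = _ := by field_simp
  have hD : 0 < constB C p η / η ^ c := by positivity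
  have hh := measureReal_pi_abs_mean_sub_ge_le (heterodyne ρ)
    (Complex.measurable_re.comp (measurable_gCore C p η)) hD
    (fun z => (Complex.abs_re_le_norm _).trans (norm_gCore_le C hp hη hη1 hη2 z)) hN
    (t := p * t / (c + p)) (by positivity)
  have hcover : Set.univ ⊆ {α : Fin N → ℂ | |fidelity (coreVec C) ρ - meanEst C p η α| ≤ t} ∪
      {α | p * t / (c + p) ≤ |(∑ i, (Complex.re ∘ gCore C p η) (α i)) / N -
        ∫ x, (Complex.re ∘ gCore C p η) x ∂(heterodyne ρ)|} := by
    intro α _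
    by_cases h : p * t / (c + p) ≤ |meanEst C p η α - E|
    · exact Or.inr h
    · left
      have e : t = c * t / (c + p) + p * t / (c + p) := by field_simp
      have h1 := abs_sub_le (fidelity (coreVec C) ρ) E (meanEst C p η α)
      rw [abs_sub_comm (fidelity _ _) E, abs_sub_comm E (meanEst _ _ _ _)] at h1
      simp only [Set.mem_ofPred_eq]
      linarith [not_le.1 h]
  have hP : IsProbabilityMeasure (Measure.pi fun _ : Fin N => heterodyne ρ) := inferInstance
  have h1 := (measureReal_mono (μ := Measure.pi fun _ : Fin N => heterodyne ρ) hcover).trans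
    (measureReal_union_le _ _)
  rw [probReal_univ] at h1
  have e : (N : ℝ) * (p * t / (c + p)) ^ 2 / (2 * (constB C p η / η ^ c) ^ 2) =
      N * ((p * t / (c + p)) ^ 2 * η ^ (2 * c) / (2 * constB C p η ^ 2)) := by
    rw [pow_mul']
    field_simp
  rw [e] at hh
  unfold heterodyneSamples
  linarith

/-- The two terms of `constK` match the two branches of the minimum in `etaMax`. The first branch
gives equality with the first term; on the second `η` does not depend on `x`, and `x ≤ 1` is used to
replace `x ^ 2` by the smaller `x ^ (2 + 2c/p)`. -/
lemma rpow_div_constK_le {c : ℕ} (hc : 0 < c) (C : Fin c → ℂ) (hC : ∑ n, ‖C n‖ ^ 2 = 1) {p : ℕ}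
    (hp : 0 < p) {x : ℝ} (hx : 0 < x) (hx1 : x ≤ 1) {η : ℝ} (hη : 0 < η) (h : η = etaMax C p x) :
    x ^ (2 + 2 * (c : ℝ) / p) / constK C p η ≤
      (p * x / (c + p)) ^ 2 * η ^ (2 * c) / (2 * constB C p η ^ 2) := by
  have hc' : (0 : ℝ) < c := by exact_mod_cast hc
  have hp' : (0 : ℝ) < p := by exact_mod_cast hp
  have hA : 0 < constA C p := one_pos.trans_le (one_le_constA C hC p)
  have hB := constB_pos C hC p hη
  have hcp : (0 : ℝ) < c + p := by positivity
  set A := constA C p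
  set B := constB C p η
  set e : ℝ := 2 * (c : ℝ) / p with he
  have he0 : 0 < e := by positivity
  have hK : constK C p η = max
      (2 * A ^ e * B ^ 2 * ((c : ℝ) + p) ^ (2 + e) / ((c : ℝ) ^ e * (p : ℝ) ^ 2))
      (2 * (p : ℝ) ^ (2 * (c : ℝ) - 2) * B ^ 2 * ((c : ℝ) + p) ^ (2 * (c : ℝ) + 2) /
        ((p : ℝ) + 1) ^ (2 * (c : ℝ))) := rfl
  rw [hK]
  have hxe : x ^ (2 + e) = x ^ 2 * x ^ e := by
    rw [Real.rpow_add hx, Real.rpow_ofNat]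
  have hxe1 : x ^ (2 + e) ≤ x ^ 2 := by
    rw [hxe]
    exact mul_le_of_le_one_right (by positivity) (Real.rpow_le_one hx.le hx1 he0.le)
  have hxp : 0 < x ^ e := Real.rpow_pos_of_pos hx _
  rcases min_choice ((c * x / ((c + p) * A)) ^ (1 / (p : ℝ)))
    (((p : ℝ) + 1) / ((p : ℝ) * ((p : ℝ) + c))) with h1 | h1
  · have h2 : η ^ (2 * c) = (c * x / ((c + p) * A)) ^ e := by
      rw [h, etaMax, h1, ← Real.rpow_natCast, ← Real.rpow_mul (by positivity), he]
      congr 1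
      push_cast
      ring
    have h3 : (c * x / ((c + p) * A)) ^ e =
        (c : ℝ) ^ e * x ^ e / (((c : ℝ) + p) ^ e * A ^ e) := by
      rw [Real.div_rpow (by positivity) (by positivity), Real.mul_rpow hc'.le hx.le,
        Real.mul_rpow hcp.le hA.le]
    have h4 : ((c : ℝ) + p) ^ (2 + e) = ((c : ℝ) + p) ^ 2 * ((c : ℝ) + p) ^ e := by
      rw [Real.rpow_add hcp, Real.rpow_ofNat]
    have q1 : 0 < (c : ℝ) ^ e := Real.rpow_pos_of_pos hc' _
    have q2 : 0 < A ^ e := Real.rpow_pos_of_pos hA _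
    have q3 : 0 < ((c : ℝ) + p) ^ e := Real.rpow_pos_of_pos hcp _
    refine (div_le_div_of_nonneg_left (by positivity) ?_ (le_max_left _ _)).trans (le_of_eq ?_)
    · rw [h4]
      positivity
    · rw [h2, h3, h4, hxe]
      field_simp
  · have h2 : η ^ (2 * c) = ((p : ℝ) + 1) ^ (2 * c) / ((p : ℝ) ^ (2 * c) * (c + p) ^ (2 * c)) := by
      rw [h, etaMax, h1, div_pow, mul_pow, add_comm (p : ℝ) c]
    have hnat : ∀ y : ℝ, y ^ (2 * (c : ℝ)) = y ^ (2 * c) := fun y => by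
      rw [← Real.rpow_natCast]
      push_cast
      rfl
    have h3 := hnat ((p : ℝ) + 1)
    have h4 : (p : ℝ) ^ (2 * (c : ℝ) - 2) = (p : ℝ) ^ (2 * c) / p ^ 2 := by
      rw [Real.rpow_sub hp', Real.rpow_ofNat, hnat]
    have h5 : ((c : ℝ) + p) ^ (2 * (c : ℝ) + 2) = ((c : ℝ) + p) ^ (2 * c) * ((c : ℝ) + p) ^ 2 := by
      rw [Real.rpow_add hcp, Real.rpow_ofNat, hnat]
    refine (div_le_div₀ (by positivity) hxe1 ?_ (le_max_right _ _)).trans (le_of_eq ?_)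
    · rw [h3, h4, h5]
      positivity
    · rw [h2, h3, h4, h5]
      field_simp

lemma etaMax_mono {c : ℕ} (C : Fin c → ℂ) (hC : ∑ n, ‖C n‖ ^ 2 = 1) (p : ℕ) {x y : ℝ}
    (hx : 0 ≤ x) (hxy : x ≤ y) : etaMax C p x ≤ etaMax C p y := by
  have hA : 0 < constA C p := one_pos.trans_le (one_le_constA C hC p)
  unfold etaMax
  gcongr

lemma etaMax_pos {c : ℕ} (hc : 0 < c) (C : Fin c → ℂ) (hC : ∑ n, ‖C n‖ ^ 2 = 1) {p : ℕ}
    (hp : 0 < p) {x : ℝ} (hx : 0 < x) : 0 < etaMax C p x := by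
  have hc' : (0 : ℝ) < c := by exact_mod_cast hc
  have hp' : (0 : ℝ) < p := by exact_mod_cast hp
  have hA : 0 < constA C p := one_pos.trans_le (one_le_constA C hC p)
  exact lt_min (Real.rpow_pos_of_pos (by positivity) _) (by positivity)

lemma etaMax_lt_one {c : ℕ} (C : Fin c → ℂ) (hC : ∑ n, ‖C n‖ ^ 2 = 1) {p : ℕ} (hp : 0 < p)
    {x : ℝ} (hx : 0 < x) (hx1 : x ≤ 1) : etaMax C p x < 1 := by
  have hp' : (0 : ℝ) < p := by exact_mod_cast hp
  have hc' : (0 : ℝ) ≤ c := by positivity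
  have hA := one_le_constA C hC p
  refine (min_le_left _ _).trans_lt (Real.rpow_lt_one (by positivity) ?_ (by positivity))
  rw [div_lt_one (by positivity)]
  nlinarith

/-- Clamping to `[0,1]` is a contraction fixing `F`, and `x ↦ x ^ M` is `M`-Lipschitz there. -/
lemma abs_pow_sub_truncEst_pow_le {c : ℕ} (C : Fin c → ℂ) (p : ℕ) (η : ℝ) {N : ℕ}
    (α : Fin N → ℂ) {F : ℝ} (hF0 : 0 ≤ F) (hF1 : F ≤ 1) (M : ℕ) :
    |F ^ M - truncEst C p η α ^ M| ≤ M * |F - meanEst C p η α| := by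
  set T := truncEst C p η α with hT
  have hT0 : 0 ≤ T := le_max_left _ _
  have hT1 : T ≤ 1 := max_le zero_le_one (min_le_left _ _)
  have h1 : |F - T| ≤ |F - meanEst C p η α| := by
    have e : F = max 0 (min 1 F) := by rw [min_eq_right hF1, max_eq_right hF0]
    conv_lhs => rw [e, hT, truncEst]
    have h2 := abs_max_sub_max_le_max 0 (min 1 F) 0 (min 1 (meanEst C p η α))
    have h3 := abs_min_sub_min_le_max 1 F 1 (meanEst C p η α)
    rw [sub_self, abs_zero] at h2 h3
    exact h2.trans (max_le (abs_nonneg _) (h3.trans (max_le (abs_nonneg _) le_rfl)))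
  calc _ ≤ |F - T| * M * max |F| |T| ^ (M - 1) := abs_pow_sub_pow_le _ _ _
    _ ≤ |F - T| * M * 1 := by
        refine mul_le_mul_of_nonneg_left (pow_le_one₀ (by positivity) (max_le ?_ ?_)) (by positivity)
        · rwa [abs_of_nonneg hF0]
        · rwa [abs_of_nonneg hT0]
    _ ≤ _ := by
        rw [mul_one, mul_comm]
        gcongr

/-- Without clamping the base can reach `1 + t`, and `(1 + t) ^ M ≤ exp (t * M)`; this stays bounded
when `t` is of order `1 / M`. -/
lemma abs_pow_sub_pow_le_of_abs_sub_le {F m t : ℝ} (hF0 : 0 ≤ F) (hF1 : F ≤ 1) (M : ℕ)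
    (h : |F - m| ≤ t) : |F ^ M - m ^ M| ≤ t * M * Real.exp (t * M) := by
  have ht : 0 ≤ t := (abs_nonneg _).trans h
  have h1 : max |F| |m| ≤ 1 + t := by
    rw [abs_of_nonneg hF0, max_le_iff, abs_le]
    rw [abs_le] at h
    refine ⟨by linarith, by linarith, by linarith⟩
  calc _ ≤ |F - m| * M * max |F| |m| ^ (M - 1) := abs_pow_sub_pow_le _ _ _
    _ ≤ t * M * (1 + t) ^ M := by
        gcongr
        exact (pow_le_pow_left₀ (by positivity) h1 _).trans
          (pow_le_pow_right₀ (by linarith) (Nat.sub_le _ _))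
    _ ≤ t * M * Real.exp (t * M) := by
        gcongr
        rw [mul_comm, Real.exp_nat_mul]
        gcongr
        linarith [Real.add_one_le_exp t]

instance isProbabilityMeasure_heterodyneSamples (ρ : DensityOperator ℕ) (N : ℕ) :
    IsProbabilityMeasure (heterodyneSamples ρ N) := by
  unfold heterodyneSamples
  infer_instance

lemma one_sub_le_measureReal_truncEst {c : ℕ} (hc : 0 < c) (C : Fin c → ℂ)
    (hC : ∑ n, ‖C n‖ ^ 2 = 1) {p : ℕ} (hp : 0 < p) (ρ : DensityOperator ℕ) {N M : ℕ} (hN : 0 < N)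
    (hM : 0 < M) {ε : ℝ} (hε : 0 < ε) {η : ℝ} (hη : 0 < η) (hη1 : η < 1)
    (hηε : η ≤ etaMax C p (ε / M)) :
    1 - 2 * Real.exp (-(N * ((p * (ε / M) / (c + p)) ^ 2 * η ^ (2 * c) /
      (2 * constB C p η ^ 2)))) ≤
      (heterodyneSamples ρ N).real {α | |fidelity (vecPower (coreVec C) M) (ρ.tensorPower M) -
        truncEst C p η α ^ M| ≤ ε} := by
  have hM' : (0 : ℝ) < M := by exact_mod_cast hM
  refine (one_sub_le_measureReal_abs_fidelity_sub_meanEst_le hc C hC hp ρ hN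
    (show 0 < ε / M by positivity) hη hη1 hηε).trans (measureReal_mono fun α hα => ?_)
  have h : |fidelity (coreVec C) ρ - meanEst C p η α| ≤ ε / M := hα
  rw [Set.mem_ofPred_eq, fidelity_tensorPower]
  refine (abs_pow_sub_truncEst_pow_le C p η α (fidelity_nonneg _ _)
    (fidelity_coreVec_le_one C hC ρ) M).trans ?_
  rw [le_div_iff₀ hM'] at h
  linarith

/-- Keeping `δ` below a fixed `δ₀ < 1` bounds `log (1 / δ)` away from zero, so the prefactor `2` is
absorbed into a multiple of it. -/
lemma two_mul_exp_neg_le {δ δ₀ x : ℝ} (hδ : 0 < δ) (hδ₀ : δ ≤ δ₀) (hδ1 : δ₀ < 1)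
    (hx : (1 + Real.log 2 / Real.log (1 / δ₀)) * Real.log (1 / δ) ≤ x) :
    2 * Real.exp (-x) ≤ δ := by
  have hpos : 0 < δ₀ := hδ.trans_le hδ₀
  have h1 : 0 < Real.log (1 / δ₀) := Real.log_pos (by rwa [lt_div_iff₀ hpos, one_mul])
  have h2 : Real.log (1 / δ₀) ≤ Real.log (1 / δ) :=
    Real.log_le_log (by positivity) (one_div_le_one_div_of_le hδ hδ₀)
  have h3 : 0 < Real.log 2 := Real.log_pos one_lt_two
  have h4 : Real.log 2 ≤ Real.log 2 / Real.log (1 / δ₀) * Real.log (1 / δ) := by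
    rw [div_mul_eq_mul_div, le_div_iff₀ h1]
    gcongr
  have h5 : Real.log (1 / δ) = - Real.log δ := by rw [one_div, Real.log_inv]
  calc 2 * Real.exp (-x) ≤ 2 * Real.exp (Real.log δ - Real.log 2) := by
        gcongr
        linarith
    _ = δ := by
        rw [Real.exp_sub, Real.exp_log hδ, Real.exp_log two_pos]
        ring

/-- The choice of `η` in the sample complexity bound for the unmodified estimate. -/
lemma exists_eta_coeff {c : ℕ} (hc : 0 < c) (C : Fin c → ℂ) (hC : ∑ n, ‖C n‖ ^ 2 = 1) {p : ℕ}
    (hp : 0 < p) {s ε₀ : ℝ} (hs : 0 < s) (hε₀ : 0 < ε₀) :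
    ∃ a : ℝ, 0 < a ∧ ∀ r : ℝ, 0 < r → r ≤ ε₀ →
      a * r ^ (1 / (p : ℝ)) < 1 ∧ a * r ^ (1 / (p : ℝ)) ≤ etaMax C p (s * r) := by
  have hc' : (0 : ℝ) < c := by exact_mod_cast hc
  have hp' : (0 : ℝ) < p := by exact_mod_cast hp
  have hA : 0 < constA C p := one_pos.trans_le (one_le_constA C hC p)
  set u : ℝ := (c * s / ((c + p) * constA C p)) ^ (1 / (p : ℝ)) with hu
  have hu0 : 0 < u := Real.rpow_pos_of_pos (by positivity) _
  -- Here `u` enforces the first branch of `etaMax`, while `v` enforces the second together with `η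
  -- < 1`; `1 / 2` could be any positive number below one. The resulting `η` is an exact multiple of
  -- `r ^ (1 / p)`, which gives a clean power law.
  set v : ℝ := min (((p : ℝ) + 1) / ((p : ℝ) * ((p : ℝ) + c))) (1 / 2) with hv
  have hv0 : 0 < v := lt_min (by positivity) (by norm_num)
  have he : 0 < ε₀ ^ (1 / (p : ℝ)) := Real.rpow_pos_of_pos hε₀ _
  refine ⟨min u (v / ε₀ ^ (1 / (p : ℝ))), lt_min hu0 (by positivity), fun r hr hrε => ?_⟩
  have hr0 : 0 < r ^ (1 / (p : ℝ)) := Real.rpow_pos_of_pos hr _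
  have h1 : min u (v / ε₀ ^ (1 / (p : ℝ))) * r ^ (1 / (p : ℝ)) ≤ u * r ^ (1 / (p : ℝ)) :=
    mul_le_mul_of_nonneg_right (min_le_left _ _) hr0.le
  have h2 : min u (v / ε₀ ^ (1 / (p : ℝ))) * r ^ (1 / (p : ℝ)) ≤ v := by
    calc _ ≤ v / ε₀ ^ (1 / (p : ℝ)) * ε₀ ^ (1 / (p : ℝ)) := by
          gcongr
          exact min_le_right _ _
      _ = v := by field_simp
  refine ⟨(h2.trans (min_le_right _ _)).trans_lt (by norm_num),
    le_min (h1.trans (le_of_eq ?_)) (h2.trans (min_le_left _ _))⟩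
  rw [hu, ← Real.mul_rpow (by positivity) hr.le]
  congr 1
  ring

end CVFidelity

/-! ### The three guarantees -/

theorem mainTheorem3 {c : ℕ} (hc : 0 < c) (C : Fin c → ℂ) (hC : ∑ n, ‖C n‖ ^ 2 = 1)
    (p : ℕ) (hp : 0 < p) :
    -- explicit failure bound for the estimate brought back into `[0,1]`, any number of copies
    (∀ (ρ : DensityOperator ℕ) (N M : ℕ), 0 < N → 0 < M → ∀ ε : ℝ, 0 < ε →
      ∀ η : ℝ, 0 < η → η < 1 → η ≤ etaMax C p (ε / M) →
        (1 - 2 * Real.exp (-(N * (p * ε / ((c + p) * M)) ^ 2 * η ^ (2 * c) /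
              (2 * constB C p η ^ 2))) ≤
          (heterodyneSamples ρ N).real
            {α | |fidelity (vecPower (coreVec C) M) (ρ.tensorPower M) -
              truncEst C p η α ^ M| ≤ ε}) ∧
        (η = etaMax C p (ε / M) →
          1 - 2 * Real.exp (-(N * ε ^ (2 + 2 * (c : ℝ) / p) /
              ((M : ℝ) ^ (2 + 2 * (c : ℝ) / p) * constK C p η))) ≤
            (heterodyneSamples ρ N).real
              {α | |fidelity (vecPower (coreVec C) M) (ρ.tensorPower M) -
                truncEst C p η α ^ M| ≤ ε})) ∧
    -- explicit failure bound for the unmodified estimate, one copy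
    (∀ (ρ : DensityOperator ℕ) (N : ℕ), 0 < N → ∀ ε : ℝ, 0 < ε → ε ≤ 1 →
      ∀ η : ℝ, η = etaMax C p ε →
        1 - 2 * Real.exp (-(N * ε ^ (2 + 2 * (c : ℝ) / p) / constK C p η)) ≤
          (heterodyneSamples ρ N).real
            {α | |fidelity (coreVec C) ρ - meanEst C p η α| ≤ ε}) ∧
    -- sample complexity for the unmodified estimate, any number of copies
    (∀ ε₀ : ℝ, 0 < ε₀ → ∀ δ₀ : ℝ, 0 < δ₀ → δ₀ < 1 → ∃ κ : ℝ, 0 < κ ∧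
      ∀ M : ℕ, 0 < M → ∀ ε : ℝ, 0 < ε → ε ≤ ε₀ →
        ∃ η : ℝ, 0 < η ∧ η < 1 ∧ η ≤ etaMax C p (ε / M) ∧
          ∀ (ρ : DensityOperator ℕ) (N : ℕ) (δ : ℝ), 0 < δ → δ ≤ δ₀ →
            κ * ((M : ℝ) / ε) ^ (2 + 2 * (c : ℝ) / p) * Real.log (1 / δ) ≤ N →
              1 - δ ≤ (heterodyneSamples ρ N).real
                {α | |fidelity (vecPower (coreVec C) M) (ρ.tensorPower M) -
                  meanEst C p η α ^ M| ≤ ε}) := by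
  have hc' : (0 : ℝ) < c := by exact_mod_cast hc
  have hp' : (0 : ℝ) < p := by exact_mod_cast hp
  refine ⟨fun ρ N M hN hM ε hε η hη hη1 hηε => ⟨?_, fun hηeq => ?_⟩,
    fun ρ N hN ε hε hε1 η hη => ?_, fun ε₀ hε₀ δ₀ hδ₀ hδ₀1 => ?_⟩
  · have hM' : (0 : ℝ) < M := by exact_mod_cast hM
    refine le_trans (le_of_eq ?_)
      (one_sub_le_measureReal_truncEst hc C hC hp ρ hN hM hε hη hη1 hηε)
    congr 4
    field_simp
  · have hM' : (0 : ℝ) < M := by exact_mod_cast hM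
    rcases le_or_gt (ε / M) 1 with h | h
    · refine le_trans ?_ (one_sub_le_measureReal_truncEst hc C hC hp ρ hN hM hε hη hη1 hηε)
      have hk := rpow_div_constK_le hc C hC hp (show 0 < ε / M by positivity) h hη hηeq
      rw [Real.div_rpow hε.le hM'.le, div_div] at hk
      rw [mul_div_assoc]
      gcongr
    -- If `ε / M > 1` then `ε > 1`, and two numbers in `[0,1]` always differ by less: the event is
    -- certain.
    · have hε1 : 1 < ε := by
        have h1 : (1 : ℝ) ≤ M := by exact_mod_cast hM
        rw [lt_div_iff₀ hM'] at h
        linarith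
      have huniv : {α : Fin N → ℂ | |fidelity (vecPower (coreVec C) M) (ρ.tensorPower M) -
          truncEst C p η α ^ M| ≤ ε} = Set.univ := by
        refine Set.eq_univ_of_forall fun α => ?_
        rw [Set.mem_ofPred_eq, fidelity_tensorPower]
        have hT0 : 0 ≤ truncEst C p η α := le_max_left _ _
        have hT1 : truncEst C p η α ≤ 1 := max_le zero_le_one (min_le_left _ _)
        have hF0 := fidelity_nonneg (coreVec C) ρ
        have hF1 := fidelity_coreVec_le_one C hC ρ
        have a1 := pow_nonneg hT0 M
        have a2 := pow_le_one₀ hT0 hT1 (n := M)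
        have a3 := pow_nonneg hF0 M
        have a4 := pow_le_one₀ hF0 hF1 (n := M)
        rw [abs_le]
        constructor <;> linarith
      rw [huniv, probReal_univ]
      linarith [Real.exp_pos (-(N * ε ^ (2 + 2 * (c : ℝ) / p) /
        ((M : ℝ) ^ (2 + 2 * (c : ℝ) / p) * constK C p η)))]
  · have hη0 : 0 < η := hη ▸ etaMax_pos hc C hC hp hε
    have hη1 : η < 1 := hη ▸ etaMax_lt_one C hC hp hε hε1
    refine le_trans ?_ (one_sub_le_measureReal_abs_fidelity_sub_meanEst_le hc C hC hp ρ hN hε hη0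
      hη1 hη.le)
    have hk := rpow_div_constK_le hc C hC hp hε hε1 hη0 hη
    rw [mul_div_assoc]
    gcongr
  · set e : ℝ := 2 * (c : ℝ) / p with he
    -- The one-copy precision is shrunk to `s * ε / M`; this factor compensates the loss `exp (s *
    -- ε) ≤ exp ε₀` in taking `M`-th powers without truncation.
    set s : ℝ := Real.exp (-ε₀) with hs
    have hs0 : 0 < s := Real.exp_pos _
    have hs1 : s ≤ 1 := Real.exp_le_one_iff.2 (by linarith)
    obtain ⟨a, ha, hη⟩ := exists_eta_coeff hc C hC hp hs0 hε₀
    have hB1 := constB_pos C hC p one_pos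
    -- The exponent per sample is at least `b * r ^ (2 + e)`, with `constB` replaced by its value at
    -- `1` so that `b` depends on neither `M` nor `ε`.
    set b : ℝ := (p * s / (c + p)) ^ 2 * a ^ (2 * c) / (2 * constB C p 1 ^ 2) with hb
    have hb0 : 0 < b := by positivity
    set κ' : ℝ := 1 + Real.log 2 / Real.log (1 / δ₀) with hκ'
    have hκ0 : 0 < κ' := by
      have h1 : 0 < Real.log (1 / δ₀) := Real.log_pos (by rwa [lt_div_iff₀ hδ₀, one_mul])
      have h3 : 0 < Real.log 2 := Real.log_pos one_lt_two
      positivity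
    refine ⟨κ' / b, by positivity, fun M hM ε hε hεε₀ => ?_⟩
    have hM' : (0 : ℝ) < M := by exact_mod_cast hM
    set r : ℝ := ε / M with hr
    have hr0 : 0 < r := by positivity
    have hrε : r ≤ ε₀ := by
      refine le_trans (div_le_self hε.le ?_) hεε₀
      exact_mod_cast hM
    obtain ⟨hη1, hη2⟩ := hη r hr0 hrε
    have hrp : 0 < r ^ (1 / (p : ℝ)) := Real.rpow_pos_of_pos hr0 _
    set η : ℝ := a * r ^ (1 / (p : ℝ)) with hηdef
    have hη0 : 0 < η := by positivity
    refine ⟨η, hη0, hη1, hη2.trans (etaMax_mono C hC p (by positivity)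
      (mul_le_of_le_one_left hr0.le hs1)), fun ρ N δ hδ hδδ₀ hN => ?_⟩
    have hre : 0 < r ^ (2 + e) := Real.rpow_pos_of_pos hr0 _
    have hlog : 0 < Real.log (1 / δ) :=
      Real.log_pos (by rw [lt_div_iff₀ hδ, one_mul]; linarith)
    have hMr : ((M : ℝ) / ε) ^ (2 + e) = (r ^ (2 + e))⁻¹ := by
      rw [← Real.inv_rpow hr0.le, hr, inv_div]
    rw [hMr] at hN
    have hN0 : 0 < N := by
      have : (0 : ℝ) < N := lt_of_lt_of_le (by positivity) hN
      exact_mod_cast this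
    have hηpow : η ^ (2 * c) = a ^ (2 * c) * r ^ e := by
      rw [hηdef, mul_pow, ← Real.rpow_natCast (r ^ _), ← Real.rpow_mul hr0.le, he]
      congr 2
      push_cast
      ring
    have hexp : κ' * Real.log (1 / δ) ≤
        N * ((p * (s * r) / (c + p)) ^ 2 * η ^ (2 * c) / (2 * constB C p η ^ 2)) := by
      have hBη := constB_pos C hC p hη0
      have hBle := constB_le_constB_one C p hη0 hη1.le
      calc κ' * Real.log (1 / δ) =
            (κ' / b * (r ^ (2 + e))⁻¹ * Real.log (1 / δ)) * (b * r ^ (2 + e)) := by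
            field_simp
        _ ≤ N * (b * r ^ (2 + e)) := by gcongr
        _ = N * ((p * (s * r) / (c + p)) ^ 2 * η ^ (2 * c) / (2 * constB C p 1 ^ 2)) := by
            rw [hηpow, hb, Real.rpow_add hr0, Real.rpow_ofNat]
            ring
        _ ≤ _ := by gcongr
    have htail := two_mul_exp_neg_le hδ hδδ₀ hδ₀1 hexp
    refine le_trans (by linarith) ((one_sub_le_measureReal_abs_fidelity_sub_meanEst_le hc C hC hp ρ
      hN0 (show 0 < s * r by positivity) hη0 hη1 hη2).trans (measureReal_mono fun α hα => ?_))
    rw [Set.mem_ofPred_eq, fidelity_tensorPower]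
    refine (abs_pow_sub_pow_le_of_abs_sub_le (fidelity_nonneg _ _) (fidelity_coreVec_le_one C hC ρ)
      M hα).trans ?_
    have e1 : s * r * M = s * ε := by
      rw [hr]
      field_simp
    rw [e1]
    calc s * ε * Real.exp (s * ε) ≤ s * ε * Real.exp ε₀ := by
          gcongr
          exact (mul_le_of_le_one_left hε.le hs1).trans hεε₀
      _ = ε := by
          rw [hs, mul_right_comm, ← Real.exp_add]
          simp
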